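/- Assume projective determinacy (PD): for every projective $A\subseteq\omega^\omega$, the two-player game of length $\omega$ on the integers with payoff set $A$ is determined. Then there is a second order theory $T$ (a set of second order sentences, under full semantics, in the vocabulary with one binary relation symbol) such that: 1. $T$ is recursive, i.e. the set of Gödel numbers of its members is recursive; 2. $T$ is complete: for every second order sentence $\varphi$ in the vocabulary, either every model of $T$ satisfies $\varphi$ or every model of $T$ satisfies $\neg\varphi$; 3. $T$ has exactly $2^{\omega}$ countable models up to isomorphism. Moreover, writing $\le_T$ and $\equiv_T$ for Turing reducibility and Turing equivalence, and $$M_x=\bigl(V_\omega\cup\{y\subseteq\omega : y\equiv_T x\},\ \in\bigr)\qquad(x\subseteq\omega),$$ $T$ can be chosen so that, for some $z\subseteq\omega$, the structure $M_x$ is a countable model of $T$ for every $x\subseteq\omega$ with $z\le_T x$; and for all $x,y\subseteq\omega$, if $M_x\cong M_y$ then $x\equiv_T y$. -/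

import Mathlib

universe u v

/-! ### Second order logic over one binary relation symbol -/

namespace SecondOrder

/-- Formulas of second order logic in the vocabulary with a single binary relation symbol `E`.
Individual variables are indexed by `i : ℕ`; the relation variables of arity `n` are
indexed by `X : ℕ`. -/
inductive SOFormula : Type
  /-- `vᵢ = vⱼ` -/
  | eq (i j : ℕ) : SOFormula
  /-- `vᵢ E vⱼ` -/
  | mem (i j : ℕ) : SOFormula
  /-- `Xⁿ(v_{w 0}, …, v_{w (n-1)})` -/
  | app (n X : ℕ) (w : Fin n → ℕ) : SOFormula
  | neg (φ : SOFormula) : SOFormula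
  | and (φ ψ : SOFormula) : SOFormula
  /-- `∀ vᵢ φ` -/
  | all (i : ℕ) (φ : SOFormula) : SOFormula
  /-- `∀ Xⁿ φ`, where `Xⁿ` ranges over the `n`-ary relations -/
  | allRel (n X : ℕ) (φ : SOFormula) : SOFormula

namespace SOFormula

/-- The free individual variables. -/
def freeVar : SOFormula → Set ℕ
  | eq i j => {i, j}
  | mem i j => {i, j}
  | app _ _ w => Set.range w
  | neg φ => φ.freeVar
  | and φ ψ => φ.freeVar ∪ ψ.freeVar
  | all i φ => φ.freeVar \ {i}
  | allRel _ _ φ => φ.freeVar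

/-- The free relation variables, given as pairs (arity, index). -/
def freeRelVar : SOFormula → Set (ℕ × ℕ)
  | eq _ _ => ∅
  | mem _ _ => ∅
  | app n X _ => {(n, X)}
  | neg φ => φ.freeRelVar
  | and φ ψ => φ.freeRelVar ∪ ψ.freeRelVar
  | all _ φ => φ.freeRelVar
  | allRel n X φ => φ.freeRelVar \ {(n, X)}

/-- A sentence is a formula without free variables of either kind. -/
def IsSentence (φ : SOFormula) : Prop :=
  φ.freeVar = ∅ ∧ φ.freeRelVar = ∅

/-- The Gödel number of a formula. -/
def code : SOFormula → ℕ
  | eq i j => Nat.pair 0 (Nat.pair i j)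
  | mem i j => Nat.pair 1 (Nat.pair i j)
  | app _ X w => Nat.pair 2 (Nat.pair X (Encodable.encode (List.ofFn w)))
  | neg φ => Nat.pair 3 φ.code
  | and φ ψ => Nat.pair 4 (Nat.pair φ.code ψ.code)
  | all i φ => Nat.pair 5 (Nat.pair i φ.code)
  | allRel n X φ => Nat.pair 6 (Nat.pair n (Nat.pair X φ.code))

theorem code_injective : Function.Injective code := by
  intro φ
  induction φ with
  | app n X w =>
    intro ψ h
    cases ψ <;> simp_all [code, Nat.pair_eq_pair]
    case app m Y w' =>
      obtain ⟨rfl, h⟩ := h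
      have h2 := List.ofFn_inj'.1 h
      cases h2
      simp
  | _ =>
    intro ψ h
    cases ψ <;> simp_all [code, Nat.pair_eq_pair] <;> grind

end SOFormula

/-- A structure `(A, E)`: a nonempty set with a binary relation. -/
structure BinStr : Type (u + 1) where
  carrier : Type u
  nonempty : Nonempty carrier
  rel : carrier → carrier → Prop

/-- Isomorphism of structures. -/
def BinStr.Iso (M : BinStr.{u}) (N : BinStr.{v}) : Prop :=
  Nonempty (M.rel ≃r N.rel)

/-- Tarskian satisfaction with full second order semantics: the assignment `s` interprets the
individual variables, `S` the relation variables, and `∀ Xⁿ` ranges over all `n`-ary relations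
on the domain. -/
def Sat (M : BinStr.{u}) :
    SOFormula → (ℕ → M.carrier) → ((p : ℕ × ℕ) → (Fin p.1 → M.carrier) → Prop) → Prop
  | .eq i j, s, _ => s i = s j
  | .mem i j, s, _ => M.rel (s i) (s j)
  | .app n X w, s, S => S (n, X) (fun k => s (w k))
  | .neg φ, s, S => ¬ Sat M φ s S
  | .and φ ψ, s, S => Sat M φ s S ∧ Sat M ψ s S
  | .all i φ, s, S => ∀ a : M.carrier, Sat M φ (Function.update s i a) S
  | .allRel n X φ, s, S =>
      ∀ R : (Fin n → M.carrier) → Prop, Sat M φ s (Function.update S (n, X) R)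

/-- `M ⊨ φ` (used for sentences, where the assignment is irrelevant). -/
def Models (M : BinStr.{u}) (φ : SOFormula) : Prop :=
  ∀ s S, Sat M φ s S

/-- `M ⊨ T`. -/
def ModelsTheory (M : BinStr.{u}) (T : Set SOFormula) : Prop :=
  ∀ φ ∈ T, Models M φ

/-- A second order theory is a set of sentences. -/
def IsTheory (T : Set SOFormula) : Prop :=
  ∀ φ ∈ T, φ.IsSentence

/-- The set of Gödel numbers of the members of `T` is recursive. -/
def IsRecursive (T : Set SOFormula) : Prop :=
  ComputablePred fun n : ℕ => ∃ φ ∈ T, φ.code = n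

/-- `T` decides every second order sentence: `T ⊨ φ` or `T ⊨ ¬ φ`. -/
def IsComplete (T : Set SOFormula) : Prop :=
  ∀ φ : SOFormula, φ.IsSentence →
    (∀ M : BinStr.{u}, ModelsTheory M T → Models M φ) ∨
      (∀ M : BinStr.{u}, ModelsTheory M T → Models M φ.neg)

/-- Isomorphism, as an equivalence relation on the countable models of `T`. -/
def countableModelSetoid (T : Set SOFormula) :
    Setoid {M : BinStr.{u} // Countable M.carrier ∧ ModelsTheory M T} where
  r M N := M.1.Iso N.1
  iseqv :=
    { refl := fun _ => ⟨RelIso.refl _⟩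
      symm := fun ⟨e⟩ => ⟨e.symm⟩
      trans := fun ⟨e⟩ ⟨f⟩ => ⟨e.trans f⟩ }

/-- The number of countable models of `T` up to isomorphism. -/
noncomputable def numCountableModels (T : Set SOFormula) : Cardinal.{u + 1} :=
  Cardinal.mk (Quotient (countableModelSetoid.{u} T))

end SecondOrder

/-! ### Projective determinacy -/

namespace Projective

/-- `Σ¹ₙ` (boldface) subsets of a topological space: `Σ¹₀` is the class of open sets, and a
`Σ¹ₙ₊₁` set is the projection along `ℕ → ℕ` of the complement of a `Σ¹ₙ` set. -/
def IsSigmaOne : ℕ → (Y : Type) → [TopologicalSpace Y] → Set Y → Prop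
  | 0, _, _, A => IsOpen A
  | n + 1, Y, _, A => ∃ B : Set (Y × (ℕ → ℕ)), IsSigmaOne n (Y × (ℕ → ℕ)) B ∧ A = Prod.fst '' Bᶜ

/-- The projective subsets of Baire space. -/
def IsProjective (A : Set (ℕ → ℕ)) : Prop :=
  ∃ n, IsSigmaOne n (ℕ → ℕ) A

/-- The first `k` moves of the play `x`. -/
def history (x : ℕ → ℕ) (k : ℕ) : List ℕ :=
  (List.range k).map x

/-- In the play `x`, player I (who makes the moves `x 0, x 2, …`) follows the strategy `σ`. -/
def FollowsI (σ : List ℕ → ℕ) (x : ℕ → ℕ) : Prop :=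
  ∀ n, x (2 * n) = σ (history x (2 * n))

/-- In the play `x`, player II (who makes the moves `x 1, x 3, …`) follows the strategy `τ`. -/
def FollowsII (τ : List ℕ → ℕ) (x : ℕ → ℕ) : Prop :=
  ∀ n, x (2 * n + 1) = τ (history x (2 * n + 1))

/-- One of the players has a winning strategy in the game on `ℕ` with payoff set `A` for I. -/
def Determined (A : Set (ℕ → ℕ)) : Prop :=
  (∃ σ, ∀ x, FollowsI σ x → x ∈ A) ∨ (∃ τ, ∀ x, FollowsII τ x → x ∉ A)

/-- Projective determinacy. -/
def PD : Prop :=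
  ∀ A : Set (ℕ → ℕ), IsProjective A → Determined A

end Projective

/-! ### The structures `M_x = (V_ω ∪ {y ⊆ ω : y ≡_T x}, ∈)` -/

namespace TuringModel

open Classical in
/-- The characteristic function of a set of natural numbers. -/
noncomputable def char (x : Set ℕ) : ℕ →. ℕ :=
  fun n => Part.some (if n ∈ x then 1 else 0)

/-- `x ≤_T y`. -/
def TuringLE (x y : Set ℕ) : Prop :=
  TuringReducible (char x) (char y)

/-- `x ≡_T y`. -/
def TuringEq (x y : Set ℕ) : Prop :=
  TuringLE x y ∧ TuringLE y x

/-- The subset of the von Neumann ordinal `ω` corresponding to `y ⊆ ℕ`. -/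
noncomputable def toZF (y : Set ℕ) : ZFSet.{0} :=
  ZFSet.range fun n : y => ((n : ℕ) : Ordinal.{0}).toZFSet

/-- `M_x = (V_ω ∪ {y ⊆ ω : y ≡_T x}, ∈)`. -/
noncomputable def model (x : Set ℕ) : SecondOrder.BinStr.{1} where
  carrier := {a : ZFSet.{0} //
    a ∈ ZFSet.vonNeumann Ordinal.omega0 ∨ ∃ y : Set ℕ, TuringEq y x ∧ a = toZF y}
  nonempty := ⟨⟨toZF x, Or.inr ⟨x, ⟨TuringReducible.refl _, TuringReducible.refl _⟩, rfl⟩⟩⟩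
  rel a b := a.1 ∈ b.1

end TuringModel

-- For a second order sentence `φ`, whether `M_x ⊨ φ` depends only on the Turing degree of `x`.
-- Since `M_x` is countable, and both Turing reducibility and "`Y` is isomorphic to `M_x`" are
-- definable in second order arithmetic (`turingLE_iff_forall_closed`, `describes_iff_iso`), the set
-- of such `x` is projective (`proj_sat`, `determined_holds`). Under PD, Martin's cone theorem
-- (`cone_or_cone`) gives a cone on which `φ` holds throughout or fails throughout. The sentences
-- true on a cone therefore form a complete theory, but there is no reason for it to be recursive.
--
-- The remedy is to let each model decide what is true on a cone. The axiom for `φ` says that the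
-- domain carries a copy of arithmetic and that, if `φ` holds of `M_x` on a cone, then `φ` holds of
-- `E`. Under full semantics the relations on a domain of size `ω` are those of true second order
-- arithmetic, and the premise does not mention `E`. Hence the premise has its actual truth value in
-- every such domain (`sat_cone`, `models_coneAxiom`). The axioms are given uniformly in `φ`, so
-- they are recursive, and their models are the countably infinite structures satisfying everything
-- true on a cone (`modelsTheory_coneTheory`).
--
-- Countably many cones have a common subcone, and on it every `M_x` is a model. An isomorphism
-- between the transitive sets `M_x` and `M_y` is the identity, so it forces `x ≡_T y`
-- (`turingEq_of_iso`). Degrees are countable, so continuum many `x` give continuum many isomorphism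
-- types; there are no more, because every model can be copied onto `ℕ`.

universe w

/-! ### Coincidence and isomorphism invariance of satisfaction -/

namespace SecondOrder

/-- Interpretations of the relation variables. -/
abbrev Rels (A : Type u) : Type u := (p : ℕ × ℕ) → (Fin p.1 → A) → Prop

theorem sat_congr (M : BinStr.{u}) (φ : SOFormula) {s s' : ℕ → M.carrier} {S S' : Rels M.carrier}
    (hs : ∀ i ∈ φ.freeVar, s i = s' i) (hS : ∀ p ∈ φ.freeRelVar, S p = S' p) :
    Sat M φ s S ↔ Sat M φ s' S' := by
  induction φ generalizing s s' S S' with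
  | eq i j => simp_all [Sat, SOFormula.freeVar]
  | mem i j => simp_all [Sat, SOFormula.freeVar]
  | app n X w => simp_all [Sat, SOFormula.freeVar, SOFormula.freeRelVar]
  | neg φ ih => exact not_congr (ih hs hS)
  | and φ ψ ih₁ ih₂ =>
    exact and_congr (ih₁ (fun i hi => hs i (Or.inl hi)) fun p hp => hS p (Or.inl hp))
      (ih₂ (fun i hi => hs i (Or.inr hi)) fun p hp => hS p (Or.inr hp))
  | all i φ ih =>
    refine forall_congr' fun a => ih (fun j hj => ?_) hS
    by_cases h : j = i
    · subst h; simp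
    · simpa [Function.update_of_ne h] using hs j ⟨hj, h⟩
  | allRel n X φ ih =>
    refine forall_congr' fun R => ih hs fun p hp => ?_
    by_cases h : p = (n, X)
    · subst h; simp
    · simpa [Function.update_of_ne h] using hS p ⟨hp, h⟩

theorem sat_iso {M : BinStr.{u}} {N : BinStr.{v}} (e : M.rel ≃r N.rel) (φ : SOFormula)
    (s : ℕ → M.carrier) (S : Rels M.carrier) :
    Sat M φ s S ↔ Sat N φ (fun i => e (s i)) (fun p (w : Fin p.1 → N.carrier) => S p fun k => e.symm (w k)) := by
  induction φ generalizing s S with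
  | eq i j => simp [Sat]
  | mem i j => simp [Sat, e.map_rel_iff]
  | app n X w => simp [Sat]
  | neg φ ih => exact not_congr (ih s S)
  | and φ ψ ih₁ ih₂ => exact and_congr (ih₁ s S) (ih₂ s S)
  | all i φ ih =>
    have key : ∀ a, (fun j => e (Function.update s i a j)) =
        Function.update (fun j => e (s j)) i (e a) := fun a => by
      funext j
      by_cases h : j = i
      · subst h; simp
      · simp [h]
    simp only [Sat, ih, key]
    exact (e.surjective.forall (p := fun b => Sat N φ (Function.update (fun j => e (s j)) i b)
      fun p (w : Fin p.1 → N.carrier) => S p fun k => e.symm (w k))).symm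
  | allRel n X φ ih =>
    have key : ∀ R : (Fin n → M.carrier) → Prop,
        (fun (p : ℕ × ℕ) (w : Fin p.1 → N.carrier) => Function.update S (n, X) R p fun k => e.symm (w k)) =
        Function.update (fun (p : ℕ × ℕ) (w : Fin p.1 → N.carrier) => S p fun k => e.symm (w k)) (n, X)
          (fun w : Fin n → N.carrier => R fun k => e.symm (w k)) := fun R => by
      funext p
      by_cases h : p = (n, X)
      · subst h; simp
      · simp [h]
    simp only [Sat, ih, key]
    refine ⟨fun h R => ?_, fun h R => h _⟩
    simpa using h fun w => R fun k => e (w k)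

theorem models_iso {M : BinStr.{u}} {N : BinStr.{v}} (e : M.Iso N) {φ : SOFormula}
    (h : Models M φ) : Models N φ := by
  obtain ⟨e⟩ := e
  intro s S
  exact (sat_iso e.symm φ s S).2 (h _ _)

theorem BinStr.Iso.symm {M : BinStr.{u}} {N : BinStr.{v}} (e : M.Iso N) : N.Iso M :=
  e.elim fun e => ⟨e.symm⟩

theorem BinStr.Iso.trans {M : BinStr.{u}} {N : BinStr.{v}} {K : BinStr.{w}} (e : M.Iso N)
    (f : N.Iso K) : M.Iso K :=
  e.elim fun e => f.elim fun f => ⟨e.trans f⟩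

theorem models_iff_of_isSentence {M : BinStr.{u}} {φ : SOFormula} (h : φ.IsSentence)
    (s : ℕ → M.carrier) (S : Rels M.carrier) : Models M φ ↔ Sat M φ s S := by
  refine ⟨fun H => H s S, fun H s' S' => (sat_congr M φ ?_ ?_).1 H⟩ <;> simp [h.1, h.2]

theorem models_neg_iff {M : BinStr.{u}} {φ : SOFormula} (h : φ.IsSentence) :
    Models M φ.neg ↔ ¬ Models M φ := by
  obtain ⟨a⟩ := M.nonempty
  rw [models_iff_of_isSentence h (fun _ => a) fun _ _ => True,
    models_iff_of_isSentence (φ := φ.neg) h (fun _ => a) fun _ _ => True]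
  rfl

/-! ### A primitive recursive enumeration of properties of one binary relation -/

namespace SOFormula

/-- The formula does not use the symbol `E`. -/
def MemFree : SOFormula → Prop
  | eq _ _ => True
  | mem _ _ => False
  | app _ _ _ => True
  | neg φ => φ.MemFree
  | and φ ψ => φ.MemFree ∧ ψ.MemFree
  | all _ φ => φ.MemFree
  | allRel _ _ φ => φ.MemFree

/-- Replace the symbol `E` by the relation variable `X₀²`, after renaming `Xᵢⁿ` to `Xᵢ₊₁ⁿ`. -/
def relativize : SOFormula → SOFormula
  | eq i j => eq i j
  | mem i j => app 2 0 ![i, j]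
  | app n X w => app n (X + 1) w
  | neg φ => neg φ.relativize
  | and φ ψ => and φ.relativize ψ.relativize
  | all i φ => all i φ.relativize
  | allRel n X φ => allRel n (X + 1) φ.relativize

theorem lt_pair_of_pos {a : ℕ} (h : 0 < a) (b : ℕ) : b < Nat.pair a b := by
  unfold Nat.pair
  split_ifs <;> nlinarith

theorem snd_unpair_lt {n : ℕ} (h : n.unpair.1 ≠ 0) : n.unpair.2 < n := by
  conv_rhs => rw [← Nat.pair_unpair n]
  exact lt_pair_of_pos (Nat.pos_of_ne_zero h) _

/-- A total function on `ℕ` that maps the Gödel number of `φ` to `φ.relativize`. -/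
def ofCode (n : ℕ) : SOFormula :=
  if n.unpair.1 = 0 then eq n.unpair.2.unpair.1 n.unpair.2.unpair.2
  else if n.unpair.1 = 1 then app 2 0 ![n.unpair.2.unpair.1, n.unpair.2.unpair.2]
  else if n.unpair.1 = 2 then
    app _ (n.unpair.2.unpair.1 + 1) (Denumerable.ofNat (List ℕ) n.unpair.2.unpair.2).get
  else if h : n.unpair.1 = 3 then neg (ofCode n.unpair.2)
  else if h : n.unpair.1 = 4 then
    and (ofCode n.unpair.2.unpair.1) (ofCode n.unpair.2.unpair.2)
  else if h : n.unpair.1 = 5 then all n.unpair.2.unpair.1 (ofCode n.unpair.2.unpair.2)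
  else allRel n.unpair.2.unpair.1 (n.unpair.2.unpair.2.unpair.1 + 1)
    (ofCode n.unpair.2.unpair.2.unpair.2)
termination_by n
decreasing_by
  all_goals
    have key : n.unpair.2 < n := snd_unpair_lt (by assumption)
    have h1 := Nat.unpair_left_le n.unpair.2
    have h2 := Nat.unpair_right_le n.unpair.2
    have h3 := Nat.unpair_right_le n.unpair.2.unpair.2
    omega

theorem ofCode_code (φ : SOFormula) : ofCode φ.code = φ.relativize := by
  induction φ with
  | app n X w =>
    rw [ofCode]
    -- The arity recovered from the code is the length of a decoded list, equal to `n` only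
    -- propositionally; passing through the sigma type avoids casts.
    have key : ∀ l, l = List.ofFn w → app l.length (X + 1) l.get = app n (X + 1) w :=
      fun l hl => congrArg (fun q : Σ n, Fin n → ℕ => app q.1 (X + 1) q.2)
        (List.ofFn_inj'.1 ((List.ofFn_get l).trans hl))
    simp only [code, Nat.unpair_pair, relativize, OfNat.ofNat_ne_zero, OfNat.ofNat_ne_one,
      if_false, if_true]
    exact key _ (by simp)
  | _ => rw [ofCode]; simp_all [code, relativize]


theorem memFree_ofCode (n : ℕ) : (ofCode n).MemFree := by
  induction n using ofCode.induct <;> rw [ofCode] <;> simp_all [MemFree]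

/-- `∀ v₀ … ∀ vₘ₋₁ φ`. -/
def closeVar (φ : SOFormula) : ℕ → SOFormula
  | 0 => φ
  | m + 1 => all m (closeVar φ m)

/-- The closure of `φ` under `∀ Xᵢ₊₁ⁿ` for all `n`, `i` whose pair is less than `m`. -/
def closeRel (φ : SOFormula) : ℕ → SOFormula
  | 0 => φ
  | m + 1 => allRel m.unpair.1 (m.unpair.2 + 1) (closeRel φ m)

theorem freeVar_closeVar (φ : SOFormula) (m : ℕ) :
    (closeVar φ m).freeVar = φ.freeVar \ {i | i < m} := by
  induction m with
  | zero => simp [closeVar]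
  | succ m ih =>
    ext i
    simp only [closeVar, freeVar, ih, Set.mem_sdiff, Set.mem_ofPred_eq, Set.mem_singleton_iff,
      Nat.lt_succ_iff_lt_or_eq]
    tauto

theorem freeRelVar_closeVar (φ : SOFormula) (m : ℕ) :
    (closeVar φ m).freeRelVar = φ.freeRelVar := by
  induction m with
  | zero => rfl
  | succ m ih => simpa [closeVar, freeRelVar]

theorem freeVar_closeRel (φ : SOFormula) (m : ℕ) : (closeRel φ m).freeVar = φ.freeVar := by
  induction m with
  | zero => rfl
  | succ m ih => simpa [closeRel, freeVar]

theorem freeRelVar_closeRel (φ : SOFormula) (m : ℕ) :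
    (closeRel φ m).freeRelVar = φ.freeRelVar \ {p | ∃ i, p.2 = i + 1 ∧ Nat.pair p.1 i < m} := by
  induction m with
  | zero => simp [closeRel]
  | succ m ih =>
    ext ⟨n, X⟩
    have key : (n, X) = (m.unpair.1, m.unpair.2 + 1) ↔ ∃ i, X = i + 1 ∧ Nat.pair n i = m := by
      constructor
      · intro h
        obtain ⟨rfl, rfl⟩ := Prod.mk.injEq .. ▸ h
        exact ⟨_, rfl, Nat.pair_unpair m⟩
      · rintro ⟨i, rfl, rfl⟩
        simp
    simp only [closeRel, freeRelVar, ih, Set.mem_sdiff, Set.mem_ofPred_eq, Set.mem_singleton_iff, key,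
      Nat.lt_succ_iff_lt_or_eq]
    constructor
    · rintro ⟨⟨h, h1⟩, h2⟩
      exact ⟨h, fun ⟨i, hi, hi'⟩ => hi'.elim (fun q => h1 ⟨i, hi, q⟩) fun q => h2 ⟨i, hi, q⟩⟩
    · rintro ⟨h, h1⟩
      exact ⟨⟨h, fun ⟨i, hi, q⟩ => h1 ⟨i, hi, .inl q⟩⟩, fun ⟨i, hi, q⟩ => h1 ⟨i, hi, .inr q⟩⟩

theorem memFree_closeVar {φ : SOFormula} (h : φ.MemFree) (m : ℕ) : (closeVar φ m).MemFree := by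
  induction m with
  | zero => exact h
  | succ m ih => exact ih

theorem memFree_closeRel {φ : SOFormula} (h : φ.MemFree) (m : ℕ) : (closeRel φ m).MemFree := by
  induction m with
  | zero => exact h
  | succ m ih => exact ih

theorem le_encode_of_mem {l : List ℕ} {a : ℕ} (h : a ∈ l) : a ≤ Encodable.encode l := by
  induction l with
  | nil => simp at h
  | cons b l ih =>
    rw [Encodable.encode_list_cons]
    rcases List.mem_cons.1 h with rfl | h
    · exact (Nat.left_le_pair _ _).trans (Nat.le_succ _)
    · exact (ih h).trans ((Nat.right_le_pair _ _).trans (Nat.le_succ _))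

theorem freeVar_ofCode_subset (n : ℕ) : (ofCode n).freeVar ⊆ {i | i ≤ n} := by
  induction n using Nat.strong_induction_on with
  | _ n ih =>
    have h0 := Nat.unpair_right_le n
    have h1 := Nat.unpair_left_le n.unpair.2
    have h2 := Nat.unpair_right_le n.unpair.2
    have h3 := Nat.unpair_right_le n.unpair.2.unpair.2
    have h4 := Nat.unpair_left_le n.unpair.2.unpair.2
    have h5 : n.unpair.1 ≠ 0 → n.unpair.2 < n := snd_unpair_lt
    rw [ofCode]
    split_ifs with a0 a1 a2 a3 a4 a5
    all_goals simp only [freeVar]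
    · rintro i (rfl | rfl) <;> simp only [Set.mem_ofPred_eq] <;> omega
    · rintro i ⟨k, rfl⟩
      fin_cases k <;> simp <;> omega
    · rintro i ⟨k, rfl⟩
      have := le_encode_of_mem (List.get_mem (Denumerable.ofNat (List ℕ) n.unpair.2.unpair.2) k)
      simp only [Denumerable.encode_ofNat] at this
      exact this.trans (h2.trans h0)
    · exact fun i hi => (ih _ (h5 a0) hi).trans h0
    · rintro i (hi | hi)
      · exact (ih _ (h1.trans_lt (h5 a0)) hi).trans (h1.trans h0)
      · exact (ih _ (h2.trans_lt (h5 a0)) hi).trans (h2.trans h0)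
    · exact fun i hi => (ih _ (h2.trans_lt (h5 a0)) hi.1).trans (h2.trans h0)
    · exact fun i hi => (ih _ (h3.trans_lt (h2.trans_lt (h5 a0))) hi).trans (h3.trans (h2.trans h0))

theorem freeRelVar_ofCode_subset (n : ℕ) :
    (ofCode n).freeRelVar ⊆ insert (2, 0) {p | ∃ i, p.2 = i + 1 ∧ p.1 ≤ n ∧ i ≤ n} := by
  have mono {m n : ℕ} (h : m ≤ n) :
      insert (2, 0) {p : ℕ × ℕ | ∃ i, p.2 = i + 1 ∧ p.1 ≤ m ∧ i ≤ m} ⊆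
        insert (2, 0) {p | ∃ i, p.2 = i + 1 ∧ p.1 ≤ n ∧ i ≤ n} :=
    Set.insert_subset_insert fun p ⟨i, h0, h1, h2⟩ => ⟨i, h0, h1.trans h, h2.trans h⟩
  induction n using Nat.strong_induction_on with
  | _ n ih =>
    have h0 := Nat.unpair_right_le n
    have h1 := Nat.unpair_left_le n.unpair.2
    have h2 := Nat.unpair_right_le n.unpair.2
    have h3 := Nat.unpair_right_le n.unpair.2.unpair.2
    have h4 := Nat.unpair_left_le n.unpair.2.unpair.2
    have h5 : n.unpair.1 ≠ 0 → n.unpair.2 < n := snd_unpair_lt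
    rw [ofCode]
    split_ifs with a0 a1 a2 a3 a4 a5
    all_goals simp only [freeRelVar]
    · exact Set.empty_subset _
    · exact fun p hp => Or.inl hp
    · rintro p rfl
      have := Encodable.length_le_encode (Denumerable.ofNat (List ℕ) n.unpair.2.unpair.2)
      simp only [Denumerable.encode_ofNat] at this
      exact Or.inr ⟨_, rfl, this.trans (h2.trans h0), h1.trans h0⟩
    · exact (ih _ (h5 a0)).trans (mono h0)
    · exact Set.union_subset ((ih _ (h1.trans_lt (h5 a0))).trans (mono (h1.trans h0)))
        ((ih _ (h2.trans_lt (h5 a0))).trans (mono (h2.trans h0)))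
    · exact (ih _ (h2.trans_lt (h5 a0))).trans (mono (h2.trans h0))
    · exact Set.sdiff_subset.trans ((ih _ (h3.trans_lt (h2.trans_lt (h5 a0)))).trans
        (mono (h3.trans (h2.trans h0))))

/-- An enumeration of formulas without the symbol `E` whose only free variable is `X₀²`: the
formula `ofCode k`, universally closed in all its other variables. -/
def unary (k : ℕ) : SOFormula :=
  closeRel (closeVar (ofCode k) (k + 1)) (Nat.pair k k + 1)

theorem memFree_unary (k : ℕ) : (unary k).MemFree :=
  memFree_closeRel (memFree_closeVar (memFree_ofCode k) _) _

theorem freeVar_unary (k : ℕ) : (unary k).freeVar = ∅ := by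
  rw [unary, freeVar_closeRel, freeVar_closeVar, Set.sdiff_eq_empty]
  exact fun i hi => Nat.lt_succ_of_le (freeVar_ofCode_subset k hi)

/-- Arities and unshifted indices in `ofCode k` are at most `k`, and `Nat.pair` is monotone, so the
bound `Nat.pair k k + 1` reaches all of them. Since `closeRel` binds only positive indices, `X₀²` is
the one variable that can survive. -/
theorem freeRelVar_unary (k : ℕ) : (unary k).freeRelVar ⊆ {(2, 0)} := by
  rw [unary, freeRelVar_closeRel, freeRelVar_closeVar]
  rintro ⟨n, X⟩ ⟨h, h'⟩
  rcases freeRelVar_ofCode_subset k h with h | ⟨i, h0, h1, h2⟩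
  · exact h
  · refine absurd ⟨i, h0, Nat.lt_succ_of_le ?_⟩ h'
    simp only at h1
    rcases h1.lt_or_eq with h1 | rfl
    · exact ((Nat.pair_lt_pair_left _ h1).trans_le
        (h2.lt_or_eq.elim (fun h => (Nat.pair_lt_pair_right _ h).le) fun h => by rw [h])).le
    · exact h2.lt_or_eq.elim (fun h => (Nat.pair_lt_pair_right _ h).le) fun h => by rw [h]

/-- Each of the more than `k` relation quantifiers strictly increases the code. The bound later
turns membership in the theory into a bounded search. -/
theorem le_code_unary (k : ℕ) : k ≤ (unary k).code := by
  have key : ∀ φ m, m ≤ (closeRel φ m).code := by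
    intro φ m
    induction m with
    | zero => exact Nat.zero_le _
    | succ m ih =>
      refine Nat.succ_le_of_lt (ih.trans_lt ?_)
      simp only [closeRel, code]
      exact ((Nat.right_le_pair _ _).trans (Nat.right_le_pair _ _)).trans_lt
        (lt_pair_of_pos (by norm_num) _)
  exact (Nat.left_le_pair k k).trans ((Nat.le_succ _).trans (key _ _))

/-- The recursion for `ofCode` read on numbers alone, so that primitive recursiveness can be proved
without an encoding instance on formulas. Numbers with a tag above 6 are treated as if the tag were
6. -/
theorem code_ofCode (n : ℕ) : (ofCode n).code =
    if n.unpair.1 = 0 then Nat.pair 0 n.unpair.2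
    else if n.unpair.1 = 1 then
      Nat.pair 2 (Nat.pair 0 (Encodable.encode [n.unpair.2.unpair.1, n.unpair.2.unpair.2]))
    else if n.unpair.1 = 2 then
      Nat.pair 2 (Nat.pair (n.unpair.2.unpair.1 + 1) n.unpair.2.unpair.2)
    else if n.unpair.1 = 3 then Nat.pair 3 (ofCode n.unpair.2).code
    else if n.unpair.1 = 4 then
      Nat.pair 4 (Nat.pair (ofCode n.unpair.2.unpair.1).code (ofCode n.unpair.2.unpair.2).code)
    else if n.unpair.1 = 5 then
      Nat.pair 5 (Nat.pair n.unpair.2.unpair.1 (ofCode n.unpair.2.unpair.2).code)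
    else Nat.pair 6 (Nat.pair n.unpair.2.unpair.1 (Nat.pair (n.unpair.2.unpair.2.unpair.1 + 1)
      (ofCode n.unpair.2.unpair.2.unpair.2).code)) := by
  rw [ofCode]
  split_ifs <;> simp [code, List.ofFn_get]

theorem primrec_code_ofCode : Primrec fun n => (ofCode n).code := by
  -- In course-of-values recursion `L` lists the values at all arguments below `n`, so its length
  -- recovers `n`.
  have e : Primrec fun L : List ℕ => L.length := Primrec.list_length
  have t : Primrec fun L : List ℕ => L.length.unpair.1 :=
    Primrec.fst.comp (Primrec.unpair.comp e)
  have r : Primrec fun L : List ℕ => L.length.unpair.2 :=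
    Primrec.snd.comp (Primrec.unpair.comp e)
  have r1 : Primrec fun L : List ℕ => L.length.unpair.2.unpair.1 :=
    Primrec.fst.comp (Primrec.unpair.comp r)
  have r2 : Primrec fun L : List ℕ => L.length.unpair.2.unpair.2 :=
    Primrec.snd.comp (Primrec.unpair.comp r)
  have r21 : Primrec fun L : List ℕ => L.length.unpair.2.unpair.2.unpair.1 :=
    Primrec.fst.comp (Primrec.unpair.comp r2)
  have r22 : Primrec fun L : List ℕ => L.length.unpair.2.unpair.2.unpair.2 :=
    Primrec.snd.comp (Primrec.unpair.comp r2)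
  have get {f : List ℕ → ℕ} (hf : Primrec f) : Primrec fun L : List ℕ => L.getD (f L) 0 :=
    (Primrec.list_getD 0).comp Primrec.id hf
  have pr {f g : List ℕ → ℕ} (hf : Primrec f) (hg : Primrec g) :
      Primrec fun L : List ℕ => Nat.pair (f L) (g L) := Primrec₂.natPair.comp hf hg
  have c (k : ℕ) : Primrec fun _ : List ℕ => k := Primrec.const k
  have tk (k : ℕ) : PrimrecPred fun L : List ℕ => L.length.unpair.1 = k :=
    Primrec.eq.comp t (c k)
  have s {f : List ℕ → ℕ} (hf : Primrec f) : Primrec fun L => f L + 1 := Primrec.succ.comp hf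
  have step := Primrec.ite (tk 0) (pr (c 0) r) <|
    Primrec.ite (tk 1) (pr (c 2) (pr (c 0) (Primrec.encode.comp
      (Primrec.list_cons.comp r1 (Primrec.list_cons.comp r2 (Primrec.const [])))))) <|
    Primrec.ite (tk 2) (pr (c 2) (pr (s r1) r2)) <|
    Primrec.ite (tk 3) (pr (c 3) (get r)) <|
    Primrec.ite (tk 4) (pr (c 4) (pr (get r1) (get r2))) <|
    Primrec.ite (tk 5) (pr (c 5) (pr r1 (get r2)))
      (pr (c 6) (pr r1 (pr (s r21) (get r22))))
  have key : Primrec₂ fun (_ : Unit) n => (ofCode n).code := by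
      refine Primrec.nat_strong_rec _
        (Primrec.option_some.comp (step.comp (Primrec.snd (α := Unit)))).to₂ fun _ n => ?_
      have get' {m : ℕ} (h : m < n) :
          ((List.range n).map fun n => (ofCode n).code).getD m 0 = (ofCode m).code := by
        simp [List.getD, h]
      conv_rhs => rw [code_ofCode]
      dsimp only
      simp only [List.length_map, List.length_range]
      split_ifs with a0 a1 a2 a3 a4 a5
      · rfl
      · rfl
      · rfl
      all_goals
        have k0 : n.unpair.2 < n := snd_unpair_lt a0
        have k1 := Nat.unpair_left_le n.unpair.2
        have k2 := Nat.unpair_right_le n.unpair.2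
        have k3 := Nat.unpair_right_le n.unpair.2.unpair.2
      · rw [get' k0]
      · rw [get' (k1.trans_lt k0), get' (k2.trans_lt k0)]
      · rw [get' (k2.trans_lt k0)]
      · rw [get' (k3.trans_lt (k2.trans_lt k0))]
  exact key.comp (Primrec.const ()) Primrec.id

theorem primrec_code_unary : Primrec fun n => (unary n).code := by
  have h1 : ∀ φ m, (closeVar φ m).code =
      Nat.rec φ.code (fun m c => Nat.pair 5 (Nat.pair m c)) m := fun φ m => by
    induction m with
    | zero => rfl
    | succ m ih => simp [closeVar, code, ih]
  have h2 : ∀ φ m, (closeRel φ m).code = Nat.rec φ.code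
      (fun m c => Nat.pair 6 (Nat.pair m.unpair.1 (Nat.pair (m.unpair.2 + 1) c))) m := fun φ m => by
    induction m with
    | zero => rfl
    | succ m ih => simp [closeRel, code, ih]
  simp only [unary, h1, h2]
  have m : Primrec fun q : ℕ × ℕ × ℕ => q.2.1 := Primrec.fst.comp Primrec.snd
  have c : Primrec fun q : ℕ × ℕ × ℕ => q.2.2 := Primrec.snd.comp Primrec.snd
  have pr {f g : ℕ × ℕ × ℕ → ℕ} (hf : Primrec f) (hg : Primrec g) :
      Primrec fun q => Nat.pair (f q) (g q) := Primrec₂.natPair.comp hf hg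
  have k (i : ℕ) : Primrec fun _ : ℕ × ℕ × ℕ => i := Primrec.const i
  refine Primrec.nat_rec' (h := fun _ q => Nat.pair 6 (Nat.pair q.1.unpair.1
    (Nat.pair (q.1.unpair.2 + 1) q.2))) (Primrec.succ.comp
      (Primrec₂.natPair.comp Primrec.id Primrec.id)) ?_ ?_
  · exact Primrec.nat_rec' (h := fun _ q => Nat.pair 5 (Nat.pair q.1 q.2)) Primrec.succ
      primrec_code_ofCode (pr (k 5) (pr m c))
  · exact pr (k 6) (pr (Primrec.fst.comp (Primrec.unpair.comp m))
      (pr (Primrec.succ.comp (Primrec.snd.comp (Primrec.unpair.comp m))) c))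

end SOFormula

/-! ### Truth of formulas without the symbol `E` -/

/-- The index shift keeps every relation quantifier of `φ` away from `X₀²`, which can therefore play
the role of `E` throughout. -/
theorem sat_relativize {A : Type u} {hA : Nonempty A} {E : A → A → Prop} (φ : SOFormula)
    (s : ℕ → A) (S : Rels A) :
    Sat ⟨A, hA, E⟩ φ.relativize s S ↔
      Sat ⟨A, hA, fun a b => S (2, 0) ![a, b]⟩ φ s fun p => S (p.1, p.2 + 1) := by
  induction φ generalizing s S with
  | eq i j => rfl
  | mem i j =>
    simp only [SOFormula.relativize, Sat]
    rw [show (fun k => s (![i, j] k)) = ![s i, s j] from List.ofFn_inj.1 rfl]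
  | app n X w => rfl
  | neg φ ih => exact not_congr (ih s S)
  | and φ ψ ih₁ ih₂ => exact and_congr (ih₁ s S) (ih₂ s S)
  | all i φ ih => exact forall_congr' fun a => ih _ _
  | allRel n X φ ih =>
    refine forall_congr' fun R => (ih _ _).trans ?_
    have h1 : Function.update S (n, X + 1) R (2, 0) = S (2, 0) :=
      Function.update_of_ne (by simp) _ _
    have h2 : (fun p : ℕ × ℕ => Function.update S (n, X + 1) R (p.1, p.2 + 1)) =
        Function.update (fun p => S (p.1, p.2 + 1)) (n, X) R := by
      funext p
      by_cases h : p = (n, X)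
      · subst h; simp
      · rw [Function.update_of_ne h, Function.update_of_ne]
        simpa [Prod.ext_iff] using h
    rw [h1, h2]

theorem sat_of_memFree {A : Type u} {hA : Nonempty A} {E E' : A → A → Prop} {φ : SOFormula}
    (h : φ.MemFree) (s : ℕ → A) (S : Rels A) :
    Sat ⟨A, hA, E⟩ φ s S ↔ Sat ⟨A, hA, E'⟩ φ s S := by
  induction φ generalizing s S with
  | eq i j => rfl
  | mem i j => exact h.elim
  | app n X w => rfl
  | neg φ ih => exact not_congr (ih h s S)
  | and φ ψ ih₁ ih₂ => exact and_congr (ih₁ h.1 s S) (ih₂ h.2 s S)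
  | all i φ ih => exact forall_congr' fun a => ih h _ _
  | allRel n X φ ih => exact forall_congr' fun R => ih h _ _

end SecondOrder

namespace TuringModel

/-! ### Functions recursive in a set -/

/-- The characteristic function of a set, with values in `ℕ`. -/
noncomputable def ind (x : Set ℕ) (n : ℕ) : ℕ := by
  classical exact if n ∈ x then 1 else 0

theorem char_eq (x : Set ℕ) : char x = fun n => Part.some (ind x n) := rfl

/-- `f` is recursive in `x`. -/
def RecIn (x : Set ℕ) (f : ℕ → ℕ) : Prop :=
  Nat.RecursiveIn {char x} fun n => Part.some (f n)

theorem turingLE_iff_recIn {x y : Set ℕ} : TuringLE y x ↔ RecIn x (ind y) :=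
  RecursiveIn.iff_nat

theorem turingLE_refl (x : Set ℕ) : TuringLE x x := TuringReducible.refl _

theorem TuringLE.trans {x y z : Set ℕ} (h : TuringLE x y) (h' : TuringLE y z) : TuringLE x z :=
  TuringReducible.trans h h'

theorem turingEq_refl (x : Set ℕ) : TuringEq x x := ⟨turingLE_refl x, turingLE_refl x⟩

theorem TuringEq.symm {x y : Set ℕ} (h : TuringEq x y) : TuringEq y x := ⟨h.2, h.1⟩

theorem TuringEq.trans {x y z : Set ℕ} (h : TuringEq x y) (h' : TuringEq y z) : TuringEq x z :=
  ⟨h.1.trans h'.1, h'.2.trans h.2⟩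

namespace RecIn

variable {x y : Set ℕ} {f g : ℕ → ℕ}

theorem mono (h : TuringLE x y) (hf : RecIn x f) : RecIn y f :=
  Nat.RecursiveIn.subst hf fun g hg => by
    rw [Set.mem_singleton_iff.1 hg]
    exact RecursiveIn.iff_nat.1 h

theorem of_primrec (hf : Primrec f) : RecIn x f :=
  (Primrec.nat_iff.1 hf).recursiveIn

theorem self (x : Set ℕ) : RecIn x (ind x) := .oracle _ rfl

theorem comp (hf : RecIn x f) (hg : RecIn x g) : RecIn x fun n => f (g n) :=
  (Nat.RecursiveIn.comp hf hg).of_eq fun n => by simp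

theorem comp₂ {F : ℕ → ℕ → ℕ} (hF : Primrec₂ F) (hf : RecIn x f) (hg : RecIn x g) :
    RecIn x fun n => F (f n) (g n) := by
  have h1 : RecIn x fun n => Nat.pair (f n) (g n) :=
    (Nat.RecursiveIn.pair hf hg).of_eq fun n => by simp [Seq.seq]
  have h2 : Primrec fun n : ℕ => F n.unpair.1 n.unpair.2 :=
    hF.comp (Primrec.fst.comp Primrec.unpair) (Primrec.snd.comp Primrec.unpair)
  simpa using (of_primrec h2).comp h1

/-- Both branches are total, so definition by cases is the arithmetic expression `χ * f + (1 - χ) *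
g`, with `χ` the characteristic function of `c`. -/
theorem ite {c : ℕ → Prop} [DecidablePred c] (hc : PrimrecPred c) (hf : RecIn x f)
    (hg : RecIn x g) : RecIn x fun n => if c n then f n else g n := by
  have h : Primrec fun n => if c n then 1 else 0 :=
    Primrec.ite hc (Primrec.const 1) (Primrec.const 0)
  have h1 : RecIn x fun n => (if c n then 1 else 0) * f n := comp₂ Primrec.nat_mul (of_primrec h) hf
  have h2 : RecIn x fun n => (1 - if c n then 1 else 0) * g n :=
    comp₂ Primrec.nat_mul (comp₂ Primrec.nat_sub (of_primrec (Primrec.const 1)) (of_primrec h)) hg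
  convert comp₂ Primrec.nat_add h1 h2 using 2 with n
  split_ifs <;> simp

theorem natRec {c : ℕ} {h : ℕ → ℕ} (h0 : h 0 = c) (hs : ∀ n, h (n + 1) = f (Nat.pair n (h n)))
    (hf : RecIn x f) : RecIn x h := by
  -- Primitive recursion carries a parameter; here it is the dummy value 0, which the step function
  -- discards by projecting.
  have key := Nat.RecursiveIn.prec (of_primrec (x := x) (Primrec.const c))
    (hf.comp (of_primrec (Primrec.snd.comp Primrec.unpair)))
  have k2 := Nat.RecursiveIn.comp key (comp₂ (x := x) Primrec₂.natPair
    (of_primrec (Primrec.const 0)) (of_primrec Primrec.id))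
  refine k2.of_eq fun n => ?_
  simp only [id, Part.bind_eq_bind, Part.bind_some, Nat.unpair_pair]
  induction n with
  | zero => simp [h0]
  | succ n ih => simp [ih, hs]

/-- The graph of `f`, as a set of natural numbers. -/
def _root_.TuringModel.graphSet (f : ℕ → ℕ) : Set ℕ := {k | f k.unpair.1 = k.unpair.2}

/-- Unbounded search through the graph finds the value. The search stops at a zero, hence `1 - ind`.
-/
theorem graphSet_self (f : ℕ → ℕ) : RecIn (graphSet f) f := by
  have h : RecIn (graphSet f) fun k => 1 - ind (graphSet f) k :=
    comp₂ Primrec.nat_sub (of_primrec (Primrec.const 1)) (self _)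
  refine (Nat.RecursiveIn.rfind h).of_eq_tot fun n => ?_
  refine Nat.mem_rfind.2 ⟨?_, fun {m} hm => ?_⟩
  · simp [ind, graphSet]
  · simp [ind, graphSet, hm.ne']

theorem turingLE_graphSet (hf : RecIn x f) : TuringLE (graphSet f) x := by
  rw [turingLE_iff_recIn]
  have h := comp₂ (F := fun a b => if a = b then 1 else 0)
    (Primrec.ite Primrec.eq (Primrec.const 1) (Primrec.const 0))
    (hf.comp (of_primrec (Primrec.fst.comp Primrec.unpair)))
    (of_primrec (x := x) (Primrec.snd.comp Primrec.unpair))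
  convert h using 2 with n
  by_cases hn : f n.unpair.1 = n.unpair.2 <;> simp [ind, graphSet, hn]

end RecIn

theorem turingLE_of_ind_comp {x y : Set ℕ} {f : ℕ → ℕ} (hf : Primrec f)
    (h : ∀ n, n ∈ y ↔ f n ∈ x) : TuringLE y x := by
  rw [turingLE_iff_recIn]
  convert (RecIn.self x).comp (RecIn.of_primrec hf) using 2 with n
  by_cases hn : f n ∈ x <;> simp [ind, h, hn]

theorem turingLE_of_finite {x : Set ℕ} (hx : x.Finite) (y : Set ℕ) : TuringLE x y := by
  rw [turingLE_iff_recIn]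
  have h1 : PrimrecPred fun n => ∃ a ∈ hx.toFinset.toList, a = n :=
    (PrimrecRel.exists_mem_list Primrec.eq).comp (Primrec.const _) Primrec.id
  classical
  refine RecIn.of_primrec ((Primrec.ite h1 (Primrec.const 1) (Primrec.const 0)).of_eq fun n => ?_)
  simp [ind]

theorem exists_upper_bound (z : ℕ → Set ℕ) : ∃ y, ∀ k, TuringLE (z k) y :=
  ⟨{n | n.unpair.2 ∈ z n.unpair.1}, fun k => turingLE_of_ind_comp (f := fun n => Nat.pair k n)
    (Primrec₂.natPair.comp (Primrec.const k) Primrec.id) fun n => by simp⟩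

/-- The join `z ⊕ x` computes `z` and determines `x`, so every cone has continuum many members. -/
theorem exists_injective_cone (z : Set ℕ) :
    ∃ f : Set ℕ → Set ℕ, Function.Injective f ∧ ∀ x, TuringLE z (f x) := by
  refine ⟨fun x => {n | (n.unpair.1 = 0 ∧ n.unpair.2 ∈ z) ∨ (n.unpair.1 = 1 ∧ n.unpair.2 ∈ x)},
    fun x y h => ?_, fun x => ?_⟩
  · ext n
    simpa using Set.ext_iff.1 h (Nat.pair 1 n)
  · exact turingLE_of_ind_comp (f := fun n => Nat.pair 0 n)
      (Primrec₂.natPair.comp (Primrec.const 0) Primrec.id) fun n => by simp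

/-! ### The functions recursive in an oracle form a countable class -/

/-- Programs with an oracle. -/
inductive OracleCode : Type
  | zero | succ | left | right | oracle
  | pair (a b : OracleCode)
  | comp (a b : OracleCode)
  | prec (a b : OracleCode)
  | rfind (a : OracleCode)

namespace OracleCode

/-- A Gödel numbering of the programs. -/
def number : OracleCode → ℕ
  | zero => Nat.pair 0 0
  | succ => Nat.pair 0 1
  | left => Nat.pair 0 2
  | right => Nat.pair 0 3
  | oracle => Nat.pair 0 4
  | pair a b => Nat.pair 1 (Nat.pair a.number b.number)
  | comp a b => Nat.pair 2 (Nat.pair a.number b.number)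
  | prec a b => Nat.pair 3 (Nat.pair a.number b.number)
  | rfind a => Nat.pair 4 a.number

theorem number_injective : Function.Injective number := by
  intro a
  induction a <;> intro b h <;> cases b <;> simp_all [number, Nat.pair_eq_pair] <;> grind

instance : Countable OracleCode := number_injective.countable

/-- The partial function computed by a program. -/
def eval (g : ℕ →. ℕ) : OracleCode → ℕ →. ℕ
  | zero => fun _ => 0
  | succ => Nat.succ
  | left => fun n => (Nat.unpair n).1
  | right => fun n => (Nat.unpair n).2
  | oracle => g
  | pair a b => fun n => Nat.pair <$> a.eval g n <*> b.eval g n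
  | comp a b => fun n => b.eval g n >>= a.eval g
  | prec a b => fun p =>
      let (c, n) := Nat.unpair p
      n.rec (a.eval g c) fun y IH => do
        let i ← IH
        b.eval g (Nat.pair c (Nat.pair y i))
  | rfind a => fun c => Nat.rfind fun n => (fun m => m = 0) <$> a.eval g (Nat.pair c n)

theorem exists_eval_eq {g f : ℕ →. ℕ} (hf : Nat.RecursiveIn {g} f) : ∃ c, eval g c = f := by
  induction hf with
  | zero => exact ⟨zero, rfl⟩
  | succ => exact ⟨succ, rfl⟩
  | left => exact ⟨left, rfl⟩
  | right => exact ⟨right, rfl⟩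
  | oracle g hg => exact ⟨oracle, hg.symm⟩
  | pair _ _ h₁ h₂ =>
    obtain ⟨⟨a, rfl⟩, b, rfl⟩ := And.intro h₁ h₂
    exact ⟨pair a b, rfl⟩
  | comp _ _ h₁ h₂ =>
    obtain ⟨⟨a, rfl⟩, b, rfl⟩ := And.intro h₁ h₂
    exact ⟨comp a b, rfl⟩
  | prec _ _ h₁ h₂ =>
    obtain ⟨⟨a, rfl⟩, b, rfl⟩ := And.intro h₁ h₂
    exact ⟨prec a b, rfl⟩
  | rfind _ h₁ =>
    obtain ⟨a, rfl⟩ := h₁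
    exact ⟨rfind a, rfl⟩

end OracleCode

theorem countable_recursiveIn (g : ℕ →. ℕ) : {f | Nat.RecursiveIn {g} f}.Countable :=
  (Set.countable_range (OracleCode.eval g)).mono fun _ hf => OracleCode.exists_eval_eq hf

theorem ind_injective : Function.Injective ind := fun x y h => by
  ext n
  have := congrFun h n
  unfold ind at this
  split_ifs at this <;> simp_all

theorem countable_turingLE (x : Set ℕ) : {y | TuringLE y x}.Countable := by
  refine Set.MapsTo.countable_of_injOn (f := char) (fun y hy => RecursiveIn.iff_nat.1 hy)
    (fun y _ y' _ h => ?_) (countable_recursiveIn (char x))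
  refine ind_injective (funext fun n => ?_)
  simpa [char_eq] using congrFun h n

/-! ### A second order description of Turing reducibility -/

/-- The sections of `W` are graphs of partial functions that include the basic ones and the
characteristic function of `x`, and they are closed under the operations that generate the
functions recursive in `x`. -/
def Closed (W : ℕ → ℕ → ℕ → Prop) (x : Set ℕ) : Prop :=
  (∃ k, ∀ n m, W k n m ↔ m = 0) ∧
  (∃ k, ∀ n m, W k n m ↔ m = n + 1) ∧
  (∃ k, ∀ n m, W k n m ↔ ∃ b, Nat.pair m b = n) ∧
  (∃ k, ∀ n m, W k n m ↔ ∃ a, Nat.pair a m = n) ∧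
  (∃ k, ∀ n m, W k n m ↔ (n ∈ x ∧ m = 1) ∨ (n ∉ x ∧ m = 0)) ∧
  (∀ i j, ∃ k, ∀ n m, W k n m ↔ ∃ a b, W i n a ∧ W j n b ∧ Nat.pair a b = m) ∧
  (∀ i j, ∃ k, ∀ n m, W k n m ↔ ∃ a, W j n a ∧ W i a m) ∧
  (∀ i j, ∃ k, (∀ a m, W k (Nat.pair a 0) m ↔ W i a m) ∧
    ∀ a n m, W k (Nat.pair a (n + 1)) m ↔
      ∃ r, W k (Nat.pair a n) r ∧ W j (Nat.pair a (Nat.pair n r)) m) ∧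
  (∀ i, ∃ k, ∀ a m, W k a m ↔
    W i (Nat.pair a m) 0 ∧ ∀ l, l < m → ∃ r, r ≠ 0 ∧ W i (Nat.pair a l) r)

theorem mem_char_iff {x : Set ℕ} {n m : ℕ} :
    m ∈ char x n ↔ (n ∈ x ∧ m = 1) ∨ (n ∉ x ∧ m = 0) := by
  by_cases h : n ∈ x <;> simp [char, h]

/-- Recursion equations have a unique solution, so primitive recursion can be expressed by a
condition on graphs, as in `Closed`. -/
theorem prec_iff {f h F : ℕ →. ℕ} : (F = fun p =>
        let (a, n) := Nat.unpair p
        n.rec (f a) fun y IH => do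
          let i ← IH
          h (Nat.pair a (Nat.pair y i))) ↔
      (∀ a m, m ∈ F (Nat.pair a 0) ↔ m ∈ f a) ∧
    ∀ a n m, m ∈ F (Nat.pair a (n + 1)) ↔
      ∃ r, r ∈ F (Nat.pair a n) ∧ m ∈ h (Nat.pair a (Nat.pair n r)) := by
  constructor
  · rintro rfl
    simp
  · rintro ⟨h0, hs⟩
    funext p
    obtain ⟨⟨a, n⟩, rfl⟩ : ∃ q : ℕ × ℕ, p = Nat.pair q.1 q.2 := ⟨p.unpair, by simp⟩
    simp only [Nat.unpair_pair]
    induction n with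
    | zero => exact Part.ext fun m => h0 a m
    | succ n ih => exact Part.ext fun m => by simp [hs, ih]

theorem mem_rfind_iff {f : ℕ →. ℕ} {a m : ℕ} :
    (m ∈ Nat.rfind fun n => (fun m => decide (m = 0)) <$> f (Nat.pair a n)) ↔
      0 ∈ f (Nat.pair a m) ∧ ∀ l, l < m → ∃ r, r ≠ 0 ∧ r ∈ f (Nat.pair a l) := by
  refine Nat.mem_rfind.trans ?_
  simp [and_comm]

/-- The partial functions recursive in `x` form the least class closed under the generating
operations, and this class is countable. It is thus enough to quantify over classes indexed by `ℕ`,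
that is, over ternary relations `W`. -/
theorem turingLE_iff_forall_closed {y x : Set ℕ} : TuringLE y x ↔ ∀ W, Closed W x →
    ∃ k, ∀ n m, W k n m ↔ (n ∈ y ∧ m = 1) ∨ (n ∉ y ∧ m = 0) := by
  constructor
  · rintro h W ⟨hz, hs, hl, hr, ho, hp, hc, hprec, hrf⟩
    have key : ∀ f, Nat.RecursiveIn {char x} f → ∃ k, ∀ n m, W k n m ↔ m ∈ f n := by
      intro f hf
      induction hf with
      | zero => simpa [Part.zero_def] using hz
      | succ => simpa using hs
      | left =>
        refine hl.imp fun k hk n m => (hk n m).trans ?_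
        refine Iff.trans ?_ Part.mem_some_iff.symm
        exact ⟨by rintro ⟨b, rfl⟩; simp, by rintro rfl; exact ⟨n.unpair.2, by simp⟩⟩
      | right =>
        refine hr.imp fun k hk n m => (hk n m).trans ?_
        refine Iff.trans ?_ Part.mem_some_iff.symm
        exact ⟨by rintro ⟨b, rfl⟩; simp, by rintro rfl; exact ⟨n.unpair.1, by simp⟩⟩
      | oracle g hg =>
        rw [Set.mem_singleton_iff.1 hg]
        simpa only [mem_char_iff] using ho
      | pair _ _ h₁ h₂ =>
        obtain ⟨⟨i, hi⟩, j, hj⟩ := And.intro h₁ h₂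
        refine (hp i j).imp fun k hk n m => (hk n m).trans ?_
        simp only [hi, hj]
        simp [Seq.seq]
      | comp _ _ h₁ h₂ =>
        obtain ⟨⟨i, hi⟩, j, hj⟩ := And.intro h₁ h₂
        refine (hc i j).imp fun k hk n m => (hk n m).trans ?_
        simp only [hi, hj]
        exact Part.mem_bind_iff.symm
      | prec _ _ h₁ h₂ =>
        obtain ⟨⟨i, hi⟩, j, hj⟩ := And.intro h₁ h₂
        obtain ⟨k, h0, h1⟩ := hprec i j
        obtain ⟨k0, k1⟩ := prec_iff.1 rfl
        refine ⟨k, fun p => ?_⟩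
        obtain ⟨⟨a, n⟩, rfl⟩ : ∃ q : ℕ × ℕ, p = Nat.pair q.1 q.2 := ⟨p.unpair, by simp⟩
        induction n with
        | zero => exact fun m => ((h0 a m).trans (hi a m)).trans (k0 a m).symm
        | succ n ih =>
          refine fun m => (h1 a n m).trans (Iff.trans ?_ (k1 a n m).symm)
          exact exists_congr fun r => and_congr (ih r) (hj _ m)
      | rfind _ h₁ =>
        obtain ⟨i, hi⟩ := h₁
        refine (hrf i).imp fun k hk n m => (hk n m).trans ?_
        rw [mem_rfind_iff]
        simp only [hi]
    simpa only [mem_char_iff] using key _ (RecursiveIn.iff_nat.1 h)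
  · intro h
    -- Countability enters here: the class of functions recursive in `x` is itself the family of
    -- sections of some `W`.
    obtain ⟨F, hF⟩ := (countable_recursiveIn (char x)).exists_eq_range ⟨_, .zero⟩
    have mem (k) : Nat.RecursiveIn {char x} (F k) := hF.symm.subset (Set.mem_range_self k)
    have key {f : ℕ →. ℕ} (hf : Nat.RecursiveIn {char x} f) : ∃ k, F k = f := hF.subset hf
    obtain ⟨k, hk⟩ := h (fun k n m => m ∈ F k n) <| by
      refine ⟨?_, ?_, ?_, ?_, ?_, fun i j => ?_, fun i j => ?_, fun i j => ?_, fun i => ?_⟩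
      · refine (key .zero).imp fun k hk => ?_
        simp [hk, Part.zero_def]
      · refine (key .succ).imp fun k hk => ?_
        simp [hk]
      · refine (key .left).imp fun k hk n m => ?_
        simp only [hk]
        refine Part.mem_some_iff.trans ?_
        exact ⟨by rintro rfl; exact ⟨n.unpair.2, by simp⟩, by rintro ⟨b, rfl⟩; simp⟩
      · refine (key .right).imp fun k hk n m => ?_
        simp only [hk]
        refine Part.mem_some_iff.trans ?_
        exact ⟨by rintro rfl; exact ⟨n.unpair.1, by simp⟩, by rintro ⟨b, rfl⟩; simp⟩
      · refine (key (.oracle _ rfl)).imp fun k hk n m => ?_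
        simp only [hk]
        exact mem_char_iff
      · refine (key (.pair (mem i) (mem j))).imp fun k hk n m => ?_
        simp [hk, Seq.seq]
      · refine (key (.comp (mem i) (mem j))).imp fun k hk n m => ?_
        simp only [hk]
        exact Part.mem_bind_iff
      · exact (key (.prec (mem i) (mem j))).imp fun k hk => prec_iff.1 hk
      · refine (key (.rfind (mem i))).imp fun k hk n m => ?_
        simp only [hk]
        exact mem_rfind_iff
    refine RecursiveIn.iff_nat.2 ((mem k).of_eq fun n => Part.ext fun m => ?_)
    rw [hk, mem_char_iff]

/-! ### Martin's cone theorem -/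

open Projective

/-- The opponent of `σ` plays the characteristic function of `x`. As `x` computes `σ`, it computes
the whole play; conversely `x` is read off the opponent's moves. The parity `b` tells which player
follows `σ`. -/
theorem exists_play (σ : List ℕ → ℕ) {b : ℕ} (hb : b < 2) {x : Set ℕ}
    (hx : TuringLE (graphSet fun k => σ (Denumerable.ofNat (List ℕ) k)) x) :
    ∃ p : ℕ → ℕ, (∀ n, p (2 * n + b) = σ (history p (2 * n + b))) ∧
      TuringEq (graphSet p) x := by
  set τ : ℕ → ℕ := fun k => σ (Denumerable.ofNat (List ℕ) k) with hτ
  let move : ℕ → List ℕ → ℕ := fun n l => if n % 2 = b then σ l else ind x (n / 2)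
  let hist : ℕ → List ℕ := fun n => Nat.rec [] (fun n l => l ++ [move n l]) n
  let p : ℕ → ℕ := fun n => move n (hist n)
  have hist_eq : ∀ n, history p n = hist n := fun n => by
    induction n with
    | zero => rfl
    | succ n ih =>
      have : history p (n + 1) = history p n ++ [p n] := by simp [history, List.range_succ]
      rw [this, ih]
  have hτx : RecIn x τ := (RecIn.graphSet_self τ).mono hx
  have hmod : PrimrecPred fun n : ℕ => n % 2 = b :=
    Primrec.eq.comp (Primrec.nat_mod.comp Primrec.id (Primrec.const 2)) (Primrec.const b)
  have hhalf : RecIn x fun n => ind x (n / 2) :=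
    (RecIn.self x).comp (RecIn.of_primrec (Primrec.nat_div.comp Primrec.id (Primrec.const 2)))
  have hmove : RecIn x fun q => move q.unpair.1 (Denumerable.ofNat (List ℕ) q.unpair.2) :=
    RecIn.ite (hmod.comp (Primrec.fst.comp Primrec.unpair))
      (hτx.comp (RecIn.of_primrec (Primrec.snd.comp Primrec.unpair)))
      (hhalf.comp (RecIn.of_primrec (Primrec.fst.comp Primrec.unpair)))
  have happ : Primrec₂ fun a k : ℕ =>
      Encodable.encode (Denumerable.ofNat (List ℕ) a ++ [k]) :=
    Primrec.encode.comp (Primrec.list_append.comp ((Primrec.ofNat _).comp Primrec.fst)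
      (Primrec.list_cons.comp Primrec.snd (Primrec.const [])))
  have hhist : RecIn x fun n => Encodable.encode (hist n) := by
    refine RecIn.natRec rfl (fun n => ?_)
      (RecIn.comp₂ happ (RecIn.of_primrec (Primrec.snd.comp Primrec.unpair)) hmove)
    simp [hist]
  have hp : RecIn x p := by
    have := hmove.comp (RecIn.comp₂ Primrec₂.natPair (RecIn.of_primrec Primrec.id) hhist)
    simpa using this
  refine ⟨p, fun n => ?_, RecIn.turingLE_graphSet hp, ?_⟩
  · rw [hist_eq]
    exact if_pos (by omega)
  · rw [turingLE_iff_recIn]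
    -- The opponent's `n`-th move is at position `2 * n + (1 - b)`, whose half is `n`.
    have hc : Primrec fun n => 2 * n + (1 - b) :=
      Primrec.nat_add.comp (Primrec.nat_mul.comp (Primrec.const 2) Primrec.id) (Primrec.const _)
    convert (RecIn.graphSet_self p).comp (RecIn.of_primrec hc) using 2 with n
    refine ((if_neg (by omega)).trans ?_).symm
    congr 1
    omega

/-- Above a winning strategy every degree contains a play following that strategy, and by invariance
of `A` the whole degree lies on the winner's side. -/
theorem cone_or_cone (A : Set (Set ℕ)) (hA : ∀ x y, TuringEq x y → x ∈ A → y ∈ A)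
    (hdet : Determined {p | graphSet p ∈ A}) :
    (∃ z, ∀ x, TuringLE z x → x ∈ A) ∨ ∃ z, ∀ x, TuringLE z x → x ∉ A := by
  rcases hdet with ⟨σ, hσ⟩ | ⟨σ, hσ⟩
  · refine .inl ⟨graphSet fun k => σ (Denumerable.ofNat (List ℕ) k), fun x hx => ?_⟩
    obtain ⟨p, h, hp⟩ := exists_play σ (b := 0) (by norm_num) hx
    exact hA _ _ hp (hσ p h)
  · refine .inr ⟨graphSet fun k => σ (Denumerable.ofNat (List ℕ) k), fun x hx hxA => ?_⟩
    obtain ⟨p, h, hp⟩ := exists_play σ (b := 1) (by norm_num) hx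
    exact hσ p h (hA _ _ hp.symm hxA)

end TuringModel

namespace TuringModel

open SecondOrder

/-! ### The structure of `M_x` -/

/-- The von Neumann numeral of `n`. -/
noncomputable def numeral (n : ℕ) : ZFSet.{0} := ((n : ℕ) : Ordinal.{0}).toZFSet

theorem numeral_zero : numeral 0 = ∅ := by simp [numeral]

theorem numeral_succ (n : ℕ) : numeral (n + 1) = insert (numeral n) (numeral n) := by
  simp [numeral, Ordinal.toZFSet_add_one]

theorem numeral_injective : Function.Injective numeral := fun m n h => by
  simpa [numeral] using Ordinal.toZFSet_injective h

theorem mem_toZF {y : Set ℕ} {a : ZFSet.{0}} : a ∈ toZF y ↔ ∃ n, n ∈ y ∧ a = numeral n := by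
  simp [toZF, numeral, ZFSet.mem_range, eq_comm]

theorem toZF_injective : Function.Injective toZF := fun x y h => by
  ext n
  have := ZFSet.ext_iff.1 h (numeral n)
  simpa [mem_toZF, numeral_injective.eq_iff] using this

/-- The level `Vₙ` of the cumulative hierarchy. -/
noncomputable def level (n : ℕ) : ZFSet.{0} := ZFSet.vonNeumann (n : Ordinal.{0})

theorem notMem_level_zero (a : ZFSet.{0}) : a ∉ level 0 := by simp [level]

theorem mem_level_succ {n : ℕ} {a : ZFSet.{0}} : a ∈ level (n + 1) ↔ ∀ b ∈ a, b ∈ level n := by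
  rw [level, Nat.cast_add, Nat.cast_one, ZFSet.vonNeumann_add_one, ZFSet.mem_powerset]
  rfl

theorem mem_vonNeumann_omega {a : ZFSet.{0}} :
    a ∈ ZFSet.vonNeumann Ordinal.omega0 ↔ ∃ n, a ∈ level n := by
  simp only [level, ZFSet.mem_vonNeumann]
  constructor
  · intro h
    obtain ⟨n, hn⟩ := Ordinal.lt_omega0.1 h
    exact ⟨n + 1, by rw [hn]; exact_mod_cast Nat.lt_succ_self n⟩
  · rintro ⟨n, hn⟩
    exact hn.trans (Ordinal.natCast_lt_omega0 n)

theorem numeral_mem_level (n : ℕ) : numeral n ∈ level (n + 1) := by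
  rw [level, ZFSet.mem_vonNeumann, numeral, Ordinal.rank_toZFSet]
  exact_mod_cast Nat.lt_succ_self n

/-- The universe of `M_x`. -/
def Universe (x : Set ℕ) : Set ZFSet.{0} :=
  {a | a ∈ ZFSet.vonNeumann Ordinal.omega0 ∨ ∃ y : Set ℕ, TuringEq y x ∧ a = toZF y}

theorem numeral_mem_universe (x : Set ℕ) (n : ℕ) : numeral n ∈ Universe x :=
  .inl (mem_vonNeumann_omega.2 ⟨_, numeral_mem_level n⟩)

theorem mem_universe_of_mem {x : Set ℕ} {a b : ZFSet.{0}} (ha : a ∈ Universe x) (h : b ∈ a) :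
    b ∈ Universe x := by
  rcases ha with ha | ⟨y, -, rfl⟩
  · exact .inl (ZFSet.isTransitive_vonNeumann _ _ ha h)
  · obtain ⟨n, -, rfl⟩ := mem_toZF.1 h
    exact numeral_mem_universe x n

theorem finite_level (n : ℕ) : {a | a ∈ level n}.Finite := by
  induction n with
  | zero => simp [notMem_level_zero]
  | succ n ih =>
    refine Set.Finite.of_injOn (f := fun a : ZFSet.{0} => {b | b ∈ a}) (t := 𝒫 {a | a ∈ level n})
      (fun a ha b hb => mem_level_succ.1 ha b hb) (fun a _ b _ h => ?_) ih.powerset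
    exact ZFSet.ext fun z => Set.ext_iff.1 h z

theorem countable_universe (x : Set ℕ) : (Universe x).Countable := by
  have h : Universe x ⊆ (⋃ n, {a | a ∈ level n}) ∪ toZF '' {y | TuringLE y x} := by
    rintro a (ha | ⟨y, hy, rfl⟩)
    · exact .inl (Set.mem_iUnion.2 (mem_vonNeumann_omega.1 ha))
    · exact .inr ⟨y, hy.1, rfl⟩
  exact ((Set.countable_iUnion fun n => (finite_level n).countable).union
    ((countable_turingLE x).image _)).mono h

instance countable_model (x : Set ℕ) : Countable (model x).carrier :=
  (countable_universe x).to_subtype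

instance infinite_model (x : Set ℕ) : Infinite (model x).carrier :=
  Infinite.of_injective (fun n => (⟨numeral n, numeral_mem_universe x n⟩ : (model x).carrier))
    fun _ _ h => numeral_injective (congrArg Subtype.val h)

theorem finite_of_toZF_mem {x : Set ℕ} (h : toZF x ∈ ZFSet.vonNeumann Ordinal.omega0) :
    x.Finite := by
  obtain ⟨n, hn⟩ := mem_vonNeumann_omega.1 h
  refine (finite_level n).preimage (f := numeral) (numeral_injective.injOn) |>.subset fun k hk => ?_
  exact ZFSet.isTransitive_vonNeumann _ _ hn (mem_toZF.2 ⟨k, hk, rfl⟩)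

/-- Both universes are transitive, so by `∈`-induction the isomorphism is the identity and the
universes coincide. Then `x` appears in `M_y` and `y` in `M_x`. Each appears either as a set Turing
equivalent to the other parameter or inside `V_ω`; if both lie in `V_ω`, both are finite and hence
recursive. -/
theorem turingEq_of_iso {x y : Set ℕ} (h : (model x).Iso (model y)) : TuringEq x y := by
  obtain ⟨e⟩ := h
  have key : ∀ a : ZFSet.{0}, ∀ ha : a ∈ Universe x, (e ⟨a, ha⟩).1 = a := by
    intro a
    induction a using ZFSet.inductionOn with
    | _ a ih =>
      intro ha
      ext b
      constructor
      · intro hb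
        have hb' : b ∈ Universe y := mem_universe_of_mem (e ⟨a, ha⟩).2 hb
        obtain ⟨⟨c, hc⟩, hc'⟩ := e.surjective ⟨b, hb'⟩
        have h1 : c ∈ a := e.map_rel_iff (a := ⟨c, hc⟩) (b := ⟨a, ha⟩) |>.1 <| by
          rw [hc']; exact hb
        have h2 := ih c h1 hc
        rw [hc'] at h2
        exact (show b = c from h2) ▸ h1
      · intro hb
        have hb' := mem_universe_of_mem ha hb
        have h1 := e.map_rel_iff (a := ⟨b, hb'⟩) (b := ⟨a, ha⟩) |>.2 hb
        have h2 := ih b hb hb'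
        rw [← h2]
        exact h1
  have hx : toZF x ∈ Universe y := by
    have := key (toZF x) (.inr ⟨x, turingEq_refl x, rfl⟩)
    rw [← this]
    exact Subtype.property _
  have hy : toZF y ∈ Universe x := by
    obtain ⟨⟨c, hc⟩, hc'⟩ := e.surjective ⟨toZF y, .inr ⟨y, turingEq_refl y, rfl⟩⟩
    have := key c hc
    rw [hc'] at this
    exact (show toZF y = c from this) ▸ hc
  rcases hx with hx | ⟨z, hz, h⟩
  · rcases hy with hy | ⟨z, hz, h⟩
    · exact ⟨turingLE_of_finite (finite_of_toZF_mem hx) y,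
        turingLE_of_finite (finite_of_toZF_mem hy) x⟩
    · exact (toZF_injective h ▸ hz).symm
  · exact toZF_injective h ▸ hz

theorem model_iso_of_turingEq {x y : Set ℕ} (h : TuringEq x y) : (model x).Iso (model y) := by
  have hU (a : ZFSet.{0}) : a ∈ Universe x ↔ a ∈ Universe y :=
    or_congr_right (exists_congr fun z =>
      and_congr_left fun _ => ⟨fun hz => hz.trans h, fun hz => hz.trans h.symm⟩)
  exact ⟨⟨Equiv.subtypeEquivRight hU, Iff.rfl⟩⟩

theorem exists_nat_iso {M : BinStr.{u}} [Countable M.carrier] [Infinite M.carrier] :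
    ∃ Y : ℕ → ℕ → Prop, M.Iso ⟨ℕ, ⟨0⟩, Y⟩ := by
  obtain ⟨_⟩ := nonempty_denumerable M.carrier
  let e := Denumerable.eqv M.carrier
  exact ⟨fun a b => M.rel (e.symm a) (e.symm b), ⟨⟨e, by simp⟩⟩⟩

/-! ### A second order description of `M_x` -/

/-- `Y` is isomorphic to `M_x`, expressed in second order arithmetic. Here `U n` stands for the
level `Vₙ` and `W n` for the singleton of the `n`-th numeral. -/
def Describes (x : Set ℕ) (Y : ℕ → ℕ → Prop) : Prop :=
  (∀ a a', (∀ b, Y b a ↔ Y b a') → a = a') ∧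
  ∃ U W : ℕ → ℕ → Prop,
    (∀ a, ¬ U 0 a) ∧
    (∀ n a, U (n + 1) a ↔ ∀ b, Y b a → U n b) ∧
    (∀ n, ∀ P : ℕ → Prop, (∀ b, P b → U n b) → ∃ a, ∀ b, Y b a ↔ P b) ∧
    (∀ a, W 0 a ↔ ∀ b, ¬ Y b a) ∧
    (∀ n a, W (n + 1) a ↔ ∃ c, W n c ∧ ∀ b, Y b a ↔ Y b c ∨ b = c) ∧
    (∀ a, (∃ n, U n a) ∨ ∃ y : Set ℕ, TuringEq y x ∧ ∀ b, Y b a ↔ ∃ n, n ∈ y ∧ W n b) ∧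
    ∀ y : Set ℕ, TuringEq y x → ∃ a, ∀ b, Y b a ↔ ∃ n, n ∈ y ∧ W n b

theorem describes_of_iso {x : Set ℕ} {Y : ℕ → ℕ → Prop}
    (h : BinStr.Iso ⟨ℕ, ⟨0⟩, Y⟩ (model x)) : Describes x Y := by
  obtain ⟨e⟩ := h
  let f : ℕ → ZFSet.{0} := fun a => (e a).1
  have fU (a) : f a ∈ Universe x := (e a).2
  have finj {a b} (h : f a = f b) : a = b := e.injective (Subtype.ext h)
  have frel (a b) : Y b a ↔ f b ∈ f a := e.map_rel_iff.symm
  have fsurj {z} (hz : z ∈ Universe x) : ∃ a, f a = z :=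
    (e.surjective ⟨z, hz⟩).imp fun a ha => congrArg Subtype.val ha
  have fmem {a z} (hz : z ∈ f a) : ∃ b, f b = z := fsurj (mem_universe_of_mem (fU a) hz)
  have fext {a} {z : ZFSet.{0}} (hz : ∀ c ∈ z, c ∈ Universe x) :
      (∀ b, f b ∈ f a ↔ f b ∈ z) ↔ f a = z := by
    refine ⟨fun h => ZFSet.ext fun c => ⟨fun hc => ?_, fun hc => ?_⟩, fun h b => by rw [h]⟩
    · obtain ⟨b, rfl⟩ := fmem hc
      exact (h b).1 hc
    · obtain ⟨b, rfl⟩ := fsurj (hz c hc)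
      exact (h b).2 hc
  have hsub {z} (hz : z ∈ Universe x) : ∀ c ∈ z, c ∈ Universe x :=
    fun c hc => mem_universe_of_mem hz hc
  refine ⟨fun a a' h => finj ((fext (hsub (fU a'))).1 fun b => ?_),
    fun n a => f a ∈ level n, fun n a => f a = numeral n, fun a => notMem_level_zero _,
    fun n a => ?_, fun n P hP => ?_, fun a => ?_, fun n a => ?_, fun a => ?_, fun y hy => ?_⟩
  · simpa only [frel] using h b
  · simp only [frel]
    rw [mem_level_succ]
    refine ⟨fun h b hb => h _ hb, fun h z hz => ?_⟩
    obtain ⟨b, rfl⟩ := fmem hz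
    exact h b hz
  -- A subset of `Vₙ` belongs to `Vₙ₊₁`, hence to `M_x`.
  · have hs : ZFSet.sep (fun z => ∃ b, P b ∧ f b = z) (level n) ∈ level (n + 1) :=
      mem_level_succ.2 fun b hb => (ZFSet.mem_sep.1 hb).1
    obtain ⟨a, ha⟩ := fsurj (.inl (mem_vonNeumann_omega.2 ⟨_, hs⟩))
    refine ⟨a, fun b => ?_⟩
    rw [frel, ha, ZFSet.mem_sep]
    constructor
    · rintro ⟨-, c, hc, h⟩
      exact finj h ▸ hc
    · exact fun h => ⟨hP b h, b, h, rfl⟩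
  · beta_reduce
    rw [← fext (hsub (numeral_mem_universe x 0))]
    simp [numeral_zero, frel]
  · beta_reduce
    rw [← fext (hsub (numeral_mem_universe x (n + 1)))]
    simp only [numeral_succ, ZFSet.mem_insert_iff, frel]
    constructor
    · intro h
      obtain ⟨c, hc⟩ := fsurj (numeral_mem_universe x n)
      refine ⟨c, hc, fun b => (h b).trans ?_⟩
      rw [← hc, or_comm]
      exact or_congr_right ⟨finj, congrArg f⟩
    · rintro ⟨c, hc, h⟩ b
      rw [h b, ← hc, or_comm]
      exact or_congr_left ⟨congrArg f, finj⟩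
  · refine (fU a).imp mem_vonNeumann_omega.1 ?_
    rintro ⟨y, hy, h⟩
    refine ⟨y, hy, fun b => ?_⟩
    rw [frel, h, mem_toZF]
  · obtain ⟨a, ha⟩ := fsurj (.inr ⟨y, hy, rfl⟩)
    refine ⟨a, fun b => ?_⟩
    rw [frel, ha, mem_toZF]

/-- The Mostowski collapse of `Y` is the isomorphism. The recursive clauses force `U` and `W` to be
the levels and the numerals, and the fullness and covering clauses make the range exactly the
universe of `M_x`. -/
theorem iso_of_describes {x : Set ℕ} {Y : ℕ → ℕ → Prop} (h : Describes x Y) :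
    BinStr.Iso ⟨ℕ, ⟨0⟩, Y⟩ (model x) := by
  obtain ⟨hext, U, W, U0, US, full, W0, WS, cov, real⟩ := h
  -- Well-foundedness is not among the clauses: it follows by induction on levels and on numerals,
  -- since every remaining point has only numerals as elements.
  have wf : WellFounded Y := by
    have accU : ∀ n a, U n a → Acc Y a := by
      intro n
      induction n with
      | zero => exact fun a ha => (U0 a ha).elim
      | succ n ih => exact fun a ha => ⟨a, fun b hb => ih b ((US n a).1 ha b hb)⟩
    have accW : ∀ n a, W n a → Acc Y a := by
      intro n
      induction n with
      | zero => exact fun a ha => ⟨a, fun b hb => ((W0 a).1 ha b hb).elim⟩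
      | succ n ih =>
        intro a ha
        obtain ⟨c, hc, h⟩ := (WS n a).1 ha
        refine ⟨a, fun b hb => ?_⟩
        rcases (h b).1 hb with h | rfl
        · exact (ih c hc).inv h
        · exact ih b hc
    refine ⟨fun a => ?_⟩
    rcases cov a with ⟨n, hn⟩ | ⟨y, -, hy⟩
    · exact accU n a hn
    · refine ⟨a, fun b hb => ?_⟩
      obtain ⟨n, -, hn⟩ := (hy b).1 hb
      exact accW n b hn
  let f : ℕ → ZFSet.{0} := wf.fix fun a F => ZFSet.range fun b : {b // Y b a} => F b b.2
  have fmem (a z) : z ∈ f a ↔ ∃ b, Y b a ∧ f b = z := by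
    simp only [f]
    rw [wf.fix_eq]
    simp [ZFSet.mem_range]
  have finj : ∀ a a', f a = f a' → a = a' := by
    intro a
    induction a using wf.induction with
    | _ a ih =>
      intro a' h
      refine hext a a' fun b => ⟨fun hb => ?_, fun hb => ?_⟩
      · obtain ⟨c, hc, h'⟩ := (fmem a' (f b)).1 (h ▸ (fmem a (f b)).2 ⟨b, hb, rfl⟩)
        exact ih b hb c h'.symm ▸ hc
      · obtain ⟨c, hc, h'⟩ := (fmem a (f b)).1 (h ▸ (fmem a' (f b)).2 ⟨b, hb, rfl⟩)
        exact ih c hc b h' ▸ hc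
  have frel (a b) : f b ∈ f a ↔ Y b a := by
    rw [fmem]
    exact ⟨fun ⟨c, hc, h⟩ => finj _ _ h ▸ hc, fun h => ⟨b, h, rfl⟩⟩
  have hU : ∀ n a, f a ∈ level n ↔ U n a := by
    intro n
    induction n with
    | zero => exact fun a => iff_of_false (notMem_level_zero _) (U0 a)
    | succ n ih =>
      intro a
      rw [mem_level_succ, US]
      simp only [fmem, ← ih]
      exact ⟨fun h b hb => h _ ⟨b, hb, rfl⟩, fun h z ⟨b, hb, e⟩ => e ▸ h b hb⟩
  have hV : ∀ n, ∀ z ∈ level n, ∃ a, f a = z := by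
    intro n
    induction n with
    | zero => exact fun z hz => (notMem_level_zero z hz).elim
    | succ n ih =>
      intro z hz
      rw [mem_level_succ] at hz
      obtain ⟨a, ha⟩ := full n (fun b => f b ∈ z) fun b hb => (hU n b).1 (hz _ hb)
      refine ⟨a, ZFSet.ext fun c => ?_⟩
      rw [fmem]
      constructor
      · rintro ⟨b, hb, rfl⟩
        exact (ha b).1 hb
      · intro hc
        obtain ⟨b, rfl⟩ := ih c (hz c hc)
        exact ⟨b, (ha b).2 hc, rfl⟩
  have hW : ∀ n a, f a = numeral n ↔ W n a := by
    intro n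
    induction n with
    | zero =>
      intro a
      rw [W0, numeral_zero, ZFSet.eq_empty]
      simp only [fmem]
      exact ⟨fun h b hb => h _ ⟨b, hb, rfl⟩, fun h z ⟨b, hb, _⟩ => h b hb⟩
    | succ n ih =>
      intro a
      rw [WS, numeral_succ]
      constructor
      · intro h
        obtain ⟨c, hc⟩ := hV _ _ (numeral_mem_level n)
        refine ⟨c, (ih c).1 hc, fun b => ?_⟩
        rw [← frel, ← frel, h, ZFSet.mem_insert_iff, ← hc, or_comm]
        exact or_congr_right ⟨finj _ _, congrArg f⟩
      · rintro ⟨c, hc, h⟩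
        rw [← (ih c).2 hc]
        ext z
        rw [ZFSet.mem_insert_iff, fmem, fmem]
        simp only [h]
        constructor
        · rintro ⟨b, hb | rfl, rfl⟩
          · exact .inr ⟨b, hb, rfl⟩
          · exact .inl rfl
        · rintro (rfl | ⟨b, hb, rfl⟩)
          · exact ⟨c, .inr rfl, rfl⟩
          · exact ⟨b, .inl hb, rfl⟩
  have hy {y : Set ℕ} {a : ℕ} (h : ∀ b, Y b a ↔ ∃ n, n ∈ y ∧ W n b) : f a = toZF y := by
    ext z
    rw [fmem, mem_toZF]
    constructor
    · rintro ⟨b, hb, rfl⟩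
      exact ((h b).1 hb).imp fun n hn => ⟨hn.1, (hW n b).2 hn.2⟩
    · rintro ⟨n, hn, rfl⟩
      obtain ⟨b, hb⟩ := hV _ _ (numeral_mem_level n)
      exact ⟨b, (h b).2 ⟨n, hn, (hW n b).1 hb⟩, hb⟩
  have fU (a) : f a ∈ Universe x := by
    rcases cov a with ⟨n, hn⟩ | ⟨y, hyx, h⟩
    · exact .inl (mem_vonNeumann_omega.2 ⟨n, (hU n a).2 hn⟩)
    · exact .inr ⟨y, hyx, hy h⟩
  have fsurj : ∀ z ∈ Universe x, ∃ a, f a = z := by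
    rintro z (hz | ⟨y, hyx, rfl⟩)
    · obtain ⟨n, hn⟩ := mem_vonNeumann_omega.1 hz
      exact hV n z hn
    · exact (real y hyx).imp fun a ha => hy ha
  exact ⟨⟨Equiv.ofBijective (fun a => (⟨f a, fU a⟩ : (model x).carrier))
    ⟨fun a b h => finj a b (congrArg Subtype.val h),
      fun z => (fsurj z.1 z.2).imp fun a ha => Subtype.ext ha⟩, fun {a b} => frel b a⟩⟩

theorem describes_iff_iso {x : Set ℕ} {Y : ℕ → ℕ → Prop} :
    Describes x Y ↔ BinStr.Iso ⟨ℕ, ⟨0⟩, Y⟩ (model x) :=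
  ⟨iso_of_describes, describes_of_iso⟩

end TuringModel

/-! ### Closure properties of the projective sets -/

namespace Projective

open SecondOrder Topology

/-- The projective subsets of a topological space. -/
def Proj (Y : Type) [TopologicalSpace Y] (A : Set Y) : Prop := ∃ n, IsSigmaOne n Y A

theorem IsSigmaOne.preimage {n : ℕ} {Y Z : Type} [TopologicalSpace Y] [TopologicalSpace Z]
    {A : Set Z} (hA : IsSigmaOne n Z A) {f : Y → Z} (hf : Continuous f) :
    IsSigmaOne n Y (f ⁻¹' A) := by
  induction n generalizing Y Z with
  | zero => exact IsOpen.preimage hf hA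
  | succ n ih =>
    obtain ⟨B, hB, rfl⟩ := hA
    refine ⟨Prod.map f id ⁻¹' B, ih hB (hf.prodMap continuous_id), ?_⟩
    ext y
    simp

/-- Only the bottom step needs an argument: in a pseudometrizable space an open set is a countable
union of closed sets, and the value `g 0` of the witness chooses the closed set. -/
theorem IsSigmaOne.succ {n : ℕ} {Y : Type} [TopologicalSpace Y]
    [TopologicalSpace.PseudoMetrizableSpace Y] {A : Set Y} (hA : IsSigmaOne n Y A) :
    IsSigmaOne (n + 1) Y A := by
  induction n generalizing Y with
  | zero =>
    let _ := TopologicalSpace.pseudoMetrizableSpacePseudoMetric Y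
    obtain ⟨F, hF, -, hFA, -⟩ := IsOpen.exists_iUnion_isClosed (show IsOpen A from hA)
    refine ⟨⋃ n, Prod.fst ⁻¹' (F n)ᶜ ∩ (fun q : Y × (ℕ → ℕ) => q.2 0) ⁻¹' {n},
      isOpen_iUnion fun n => ((hF n).isOpen_compl.preimage continuous_fst).inter
        ((isOpen_discrete {n}).preimage ((continuous_apply 0).comp continuous_snd)), ?_⟩
    ext y
    rw [← hFA]
    simp only [Set.mem_iUnion, Set.mem_image, Set.mem_compl_iff]
    constructor
    · rintro ⟨n, hn⟩
      exact ⟨(y, fun _ => n), by simpa using hn, rfl⟩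
    · rintro ⟨⟨y, g⟩, h, rfl⟩
      exact ⟨g 0, by simpa using h⟩
  | succ n ih =>
    obtain ⟨B, hB, rfl⟩ := hA
    exact ⟨B, ih hB, rfl⟩

theorem IsSigmaOne.mono {m n : ℕ} (h : m ≤ n) {Y : Type} [TopologicalSpace Y]
    [TopologicalSpace.PseudoMetrizableSpace Y] {A : Set Y} (hA : IsSigmaOne m Y A) :
    IsSigmaOne n Y A := by
  induction n, h using Nat.le_induction with
  | base => exact hA
  | succ n _ ih => exact ih.succ

/-- Each level passes through complements, so intersections at one level need unions at the level
below and conversely; the two are proved together. -/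
theorem IsSigmaOne.inter_and_union {n : ℕ} {Y : Type} [TopologicalSpace Y] {A B : Set Y}
    (hA : IsSigmaOne n Y A) (hB : IsSigmaOne n Y B) :
    IsSigmaOne n Y (A ∩ B) ∧ IsSigmaOne n Y (A ∪ B) := by
  induction n generalizing Y with
  | zero => exact ⟨IsOpen.inter hA hB, IsOpen.union hA hB⟩
  | succ n ih =>
    obtain ⟨C, hC, rfl⟩ := hA
    obtain ⟨D, hD, rfl⟩ := hB
    let f : Y × (ℕ → ℕ) → Y × (ℕ → ℕ) := fun q => (q.1, fun n => q.2 (2 * n))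
    let g : Y × (ℕ → ℕ) → Y × (ℕ → ℕ) := fun q => (q.1, fun n => q.2 (2 * n + 1))
    have hf : Continuous f := by fun_prop
    have hg : Continuous g := by fun_prop
    refine ⟨⟨f ⁻¹' C ∪ g ⁻¹' D, (ih (hC.preimage hf) (hD.preimage hg)).2, ?_⟩,
      ⟨C ∩ D, (ih hC hD).1, by rw [Set.compl_inter, Set.image_union]⟩⟩
    ext y
    constructor
    · rintro ⟨⟨⟨y, a⟩, ha, rfl⟩, ⟨⟨y', b⟩, hb, h⟩⟩
      obtain rfl : y' = y := h
      -- The two witnesses are interleaved into one; `f` and `g` extract the even and odd halves.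
      refine ⟨(y', fun n => if n % 2 = 0 then a (n / 2) else b (n / 2)), ?_, rfl⟩
      rintro (h | h)
      · exact ha (by simpa [f] using h)
      · refine hb ?_
        have e : ∀ n, (2 * n + 1) / 2 = n := by omega
        simpa [f, g, Nat.add_mod, e] using h
    · rintro ⟨⟨y, a⟩, ha, rfl⟩
      exact ⟨⟨_, fun h => ha (.inl h), rfl⟩, ⟨_, fun h => ha (.inr h), rfl⟩⟩

namespace Proj

variable {Y Z : Type} [TopologicalSpace Y] [TopologicalSpace Z]

theorem preimage {A : Set Z} (hA : Proj Z A) {f : Y → Z} (hf : Continuous f) :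
    Proj Y (f ⁻¹' A) :=
  hA.imp fun _ h => h.preimage hf

theorem compl {A : Set Y} (hA : Proj Y A) : Proj Y Aᶜ := by
  obtain ⟨n, hA⟩ := hA
  refine ⟨n + 1, Prod.fst ⁻¹' A, hA.preimage continuous_fst, ?_⟩
  ext y
  simp

theorem image_fst {A : Set (Y × (ℕ → ℕ))} (hA : Proj (Y × (ℕ → ℕ)) A) :
    Proj Y (Prod.fst '' A) := by
  obtain ⟨n, hA⟩ := hA.compl
  exact ⟨n + 1, _, hA, by rw [compl_compl]⟩

theorem forall_snd {A : Set (Y × (ℕ → ℕ))} (hA : Proj (Y × (ℕ → ℕ)) A) :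
    Proj Y {y | ∀ g, (y, g) ∈ A} := by
  convert hA.compl.image_fst.compl using 1
  ext y
  simp

theorem inter [TopologicalSpace.PseudoMetrizableSpace Y] {A B : Set Y} (hA : Proj Y A)
    (hB : Proj Y B) : Proj Y (A ∩ B) := by
  obtain ⟨m, hA⟩ := hA
  obtain ⟨n, hB⟩ := hB
  exact ⟨max m n, ((hA.mono (le_max_left m n)).inter_and_union (hB.mono (le_max_right m n))).1⟩

end Proj

/-! ### Second order definable sets over `ℕ` are projective -/

/-- The interpretation of the relation variables coded by a point of Baire space. -/
def decodeRels (F : ℕ → ℕ) : Rels ℕ := fun p w =>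
  F (Nat.pair (Nat.pair p.1 p.2) (Encodable.encode (List.ofFn w))) = 0

/-- Replace the relation coded for the variable `Xⁿ` by the one coded by `g`. -/
def setRel (n X : ℕ) (F g : ℕ → ℕ) : ℕ → ℕ := fun k =>
  if k.unpair.1 = Nat.pair n X then g k.unpair.2 else F k

theorem decodeRels_setRel (n X : ℕ) (F g : ℕ → ℕ) : decodeRels (setRel n X F g) =
    Function.update (decodeRels F) (n, X) fun w => g (Encodable.encode (List.ofFn w)) = 0 := by
  funext p
  by_cases h : p = (n, X)
  · subst h
    funext w
    simp [decodeRels, setRel]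
  · rw [Function.update_of_ne h]
    funext w
    have : ¬ (p.1 = n ∧ p.2 = X) := fun ⟨h1, h2⟩ => h (Prod.ext h1 h2)
    simp [decodeRels, setRel, Nat.pair_eq_pair, this]

theorem exists_code_rel {n : ℕ} (R : (Fin n → ℕ) → Prop) :
    ∃ g : ℕ → ℕ, R = fun w => g (Encodable.encode (List.ofFn w)) = 0 := by
  classical
  refine ⟨fun k => if ∃ w, Encodable.encode (List.ofFn w) = k ∧ R w then 0 else 1, ?_⟩
  funext w
  simp only [Encodable.encode_inj, List.ofFn_inj, exists_eq_left]
  by_cases h : R w <;> simp [h]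

theorem exists_code_rels (S : Rels ℕ) : ∃ F, S = decodeRels F := by
  choose g hg using fun p => exists_code_rel (S p)
  refine ⟨fun k => g (k.unpair.1.unpair) k.unpair.2, ?_⟩
  funext p w
  rw [hg p]
  simp [decodeRels]

/-- Relations on `ℕ` are coded by points of Baire space, so a relation quantifier is a quantifier
over `ℕ → ℕ`. Assignments are coded as well, which lets the induction pass under quantifiers. -/
theorem proj_sat (E : ℕ → ℕ → Prop) (φ : SOFormula) : Proj ((ℕ → ℕ) × (ℕ → ℕ))
    {q | Sat ⟨ℕ, ⟨0⟩, E⟩ φ q.1 (decodeRels q.2)} := by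
  induction φ with
  | eq i j =>
    have hf : Continuous fun q : (ℕ → ℕ) × (ℕ → ℕ) => (q.1 i, q.1 j) := by fun_prop
    exact ⟨0, (isOpen_discrete {p : ℕ × ℕ | p.1 = p.2}).preimage hf⟩
  | mem i j =>
    have hf : Continuous fun q : (ℕ → ℕ) × (ℕ → ℕ) => (q.1 i, q.1 j) := by fun_prop
    exact ⟨0, (isOpen_discrete {p : ℕ × ℕ | E p.1 p.2}).preimage hf⟩
  | app n X w =>
    refine ⟨0, ?_⟩
    have h : {q : (ℕ → ℕ) × (ℕ → ℕ) | Sat ⟨ℕ, ⟨0⟩, E⟩ (.app n X w) q.1 (decodeRels q.2)} =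
        -- The coordinate of `q.2` to be inspected depends on `q.1`; fixing the argument values `t`
        -- makes each piece open.
        ⋃ t : Fin n → ℕ, (⋂ k, (fun q : (ℕ → ℕ) × (ℕ → ℕ) => q.1 (w k)) ⁻¹' {t k}) ∩
          (fun q : (ℕ → ℕ) × (ℕ → ℕ) => q.2 (Nat.pair (Nat.pair n X)
            (Encodable.encode (List.ofFn t)))) ⁻¹' {0} := by
      ext q
      simp only [Sat, decodeRels, Set.mem_ofPred_eq, Set.mem_iUnion, Set.mem_inter_iff,
        Set.mem_iInter, Set.mem_preimage, Set.mem_singleton_iff]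
      refine ⟨fun h => ⟨_, fun _ => rfl, h⟩, fun ⟨t, h1, h2⟩ => ?_⟩
      rwa [← funext h1] at h2
    rw [h]
    refine isOpen_iUnion fun t => (isOpen_iInter_of_finite fun k => ?_).inter ?_
    · exact (isOpen_discrete _).preimage (by fun_prop)
    · exact (isOpen_discrete _).preimage (by fun_prop)
  | neg φ ih => exact ih.compl
  | and φ ψ ih₁ ih₂ => exact ih₁.inter ih₂
  | all i φ ih =>
    have hf : Continuous fun q : ((ℕ → ℕ) × (ℕ → ℕ)) × (ℕ → ℕ) =>
        (Function.update q.1.1 i (q.2 0), q.1.2) := by fun_prop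
    -- A number quantifier becomes a function quantifier that uses only the value `g 0`.
    convert (ih.preimage hf).forall_snd using 1
    ext q
    exact ⟨fun h g => h (g 0), fun h a => h fun _ => a⟩
  | allRel n X φ ih =>
    have hf : Continuous fun q : ((ℕ → ℕ) × (ℕ → ℕ)) × (ℕ → ℕ) =>
        (q.1.1, setRel n X q.1.2 q.2) := by
      refine (by fun_prop : Continuous fun q : ((ℕ → ℕ) × (ℕ → ℕ)) × (ℕ → ℕ) => q.1.1).prodMk ?_
      refine continuous_pi fun k => ?_
      unfold setRel
      split_ifs <;> fun_prop
    convert (ih.preimage hf).forall_snd using 1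
    ext q
    simp only [Set.mem_preimage, Set.mem_ofPred_eq, decodeRels_setRel]
    refine ⟨fun h g => h _, fun h R => ?_⟩
    obtain ⟨g, rfl⟩ := exists_code_rel R
    exact h g

theorem isProjective_sat (E : ℕ → ℕ → Prop) (φ : SOFormula) (s : ℕ → ℕ) {F : (ℕ → ℕ) → ℕ → ℕ}
    (hF : Continuous F) : IsProjective {p | Sat ⟨ℕ, ⟨0⟩, E⟩ φ s (decodeRels (F p))} :=
  (proj_sat E φ).preimage (f := fun p => (s, F p)) (by fun_prop)

end Projective

namespace SecondOrder

namespace SOFormula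

/-! ### Derived connectives -/

def or (φ ψ : SOFormula) : SOFormula := neg (and (neg φ) (neg ψ))
def imp (φ ψ : SOFormula) : SOFormula := neg (and φ (neg ψ))
def iff (φ ψ : SOFormula) : SOFormula := and (imp φ ψ) (imp ψ φ)
def ex (i : ℕ) (φ : SOFormula) : SOFormula := neg (all i (neg φ))
def exRel (n X : ℕ) (φ : SOFormula) : SOFormula := neg (allRel n X (neg φ))
def app₁ (X i : ℕ) : SOFormula := app 1 X ![i]
def app₂ (X i j : ℕ) : SOFormula := app 2 X ![i, j]
def app₃ (X i j k : ℕ) : SOFormula := app 3 X ![i, j, k]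

/-- The list of the free individual variables. -/
def freeVarList : SOFormula → List ℕ
  | eq i j => [i, j]
  | mem i j => [i, j]
  | app _ _ w => List.ofFn w
  | neg φ => φ.freeVarList
  | and φ ψ => φ.freeVarList ++ ψ.freeVarList
  | all i φ => φ.freeVarList.filter (· ≠ i)
  | allRel _ _ φ => φ.freeVarList

/-- The list of the free relation variables. -/
def freeRelVarList : SOFormula → List (ℕ × ℕ)
  | eq _ _ => []
  | mem _ _ => []
  | app n X _ => [(n, X)]
  | neg φ => φ.freeRelVarList
  | and φ ψ => φ.freeRelVarList ++ ψ.freeRelVarList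
  | all _ φ => φ.freeRelVarList
  | allRel n X φ => φ.freeRelVarList.filter (· ≠ (n, X))

/-- The lists are computable, so `decide` can find the free variables of the concrete formulas
below. -/
theorem mem_freeVarList {φ : SOFormula} {i : ℕ} : i ∈ φ.freeVarList ↔ i ∈ φ.freeVar := by
  induction φ <;> simp_all [freeVarList, freeVar]

theorem mem_freeRelVarList {φ : SOFormula} {p : ℕ × ℕ} :
    p ∈ φ.freeRelVarList ↔ p ∈ φ.freeRelVar := by
  induction φ <;> simp_all [freeRelVarList, freeRelVar]

end SOFormula

/-! ### Satisfaction of the derived connectives -/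

section Sat

variable {M : BinStr.{u}} {φ ψ : SOFormula} {s : ℕ → M.carrier} {S : Rels M.carrier}

theorem sat_eq {i j : ℕ} : Sat M (.eq i j) s S ↔ s i = s j := Iff.rfl

theorem sat_mem {i j : ℕ} : Sat M (.mem i j) s S ↔ M.rel (s i) (s j) := Iff.rfl

theorem sat_neg : Sat M φ.neg s S ↔ ¬ Sat M φ s S := Iff.rfl

theorem sat_and : Sat M (φ.and ψ) s S ↔ Sat M φ s S ∧ Sat M ψ s S := Iff.rfl

theorem sat_or : Sat M (φ.or ψ) s S ↔ Sat M φ s S ∨ Sat M ψ s S := by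
  simp [SOFormula.or, Sat, imp_iff_not_or]

theorem sat_imp : Sat M (φ.imp ψ) s S ↔ (Sat M φ s S → Sat M ψ s S) := by
  simp [SOFormula.imp, Sat]

theorem sat_iff : Sat M (φ.iff ψ) s S ↔ (Sat M φ s S ↔ Sat M ψ s S) := by
  simp [SOFormula.iff, sat_and, sat_imp, iff_def]

theorem sat_all {i : ℕ} :
    Sat M (.all i φ) s S ↔ ∀ a, Sat M φ (Function.update s i a) S := Iff.rfl

theorem sat_ex {i : ℕ} :
    Sat M (.ex i φ) s S ↔ ∃ a, Sat M φ (Function.update s i a) S := by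
  simp [SOFormula.ex, Sat]

theorem sat_allRel {n X : ℕ} :
    Sat M (.allRel n X φ) s S ↔ ∀ R, Sat M φ s (Function.update S (n, X) R) := Iff.rfl

theorem sat_exRel {n X : ℕ} :
    Sat M (.exRel n X φ) s S ↔ ∃ R, Sat M φ s (Function.update S (n, X) R) := by
  simp [SOFormula.exRel, Sat]

theorem sat_app₁ {X i : ℕ} : Sat M (.app₁ X i) s S ↔ S (1, X) ![s i] := by
  simp only [SOFormula.app₁, Sat]
  rw [show (fun k => s (![i] k)) = ![s i] from List.ofFn_inj.1 rfl]

theorem sat_app₂ {X i j : ℕ} : Sat M (.app₂ X i j) s S ↔ S (2, X) ![s i, s j] := by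
  simp only [SOFormula.app₂, Sat]
  rw [show (fun k => s (![i, j] k)) = ![s i, s j] from List.ofFn_inj.1 rfl]

theorem sat_app₃ {X i j k : ℕ} : Sat M (.app₃ X i j k) s S ↔ S (3, X) ![s i, s j, s k] := by
  simp only [SOFormula.app₃, Sat]
  rw [show (fun l => s (![i, j, k] l)) = ![s i, s j, s k] from List.ofFn_inj.1 rfl]

end Sat

theorem forall_rel₁ {A : Type u} {Q : ((Fin 1 → A) → Prop) → Prop} :
    (∀ R, Q R) ↔ ∀ W : Set A, Q fun w => w 0 ∈ W := by
  refine ⟨fun h W => h _, fun h R => ?_⟩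
  convert h {a | R ![a]} using 2 with w
  exact iff_of_eq (congrArg R (List.ofFn_inj.1 rfl))

theorem exists_rel₁ {A : Type u} {Q : ((Fin 1 → A) → Prop) → Prop} :
    (∃ R, Q R) ↔ ∃ W : Set A, Q fun w => w 0 ∈ W := by
  simpa using not_congr (forall_rel₁ (Q := fun R => ¬ Q R))

theorem forall_rel₂ {A : Type u} {Q : ((Fin 2 → A) → Prop) → Prop} :
    (∀ R, Q R) ↔ ∀ W : A → A → Prop, Q fun w => W (w 0) (w 1) := by
  refine ⟨fun h W => h _, fun h R => ?_⟩
  convert h fun a b => R ![a, b] using 2 with w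
  exact iff_of_eq (congrArg R (List.ofFn_inj.1 rfl))

theorem exists_rel₂ {A : Type u} {Q : ((Fin 2 → A) → Prop) → Prop} :
    (∃ R, Q R) ↔ ∃ W : A → A → Prop, Q fun w => W (w 0) (w 1) := by
  simpa using not_congr (forall_rel₂ (Q := fun R => ¬ Q R))

theorem forall_rel₃ {A : Type u} {Q : ((Fin 3 → A) → Prop) → Prop} :
    (∀ R, Q R) ↔ ∀ W : A → A → A → Prop, Q fun w => W (w 0) (w 1) (w 2) := by
  refine ⟨fun h W => h _, fun h R => ?_⟩
  convert h fun a b c => R ![a, b, c] using 2 with w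
  exact iff_of_eq (congrArg R (List.ofFn_inj.1 rfl))

namespace SOFormula

/-! ### Arithmetic

The relation variables `X₁²`, `X₂²`, `X₀³` stand for the successor function, the ordering and the
pairing function `Nat.pair`. -/

def suc (i j : ℕ) : SOFormula := app₂ 1 i j
def lt (i j : ℕ) : SOFormula := app₂ 2 i j
def pair (i j k : ℕ) : SOFormula := app₃ 0 i j k
-- The bound variables 50 here and 51 in `isOne` are reserved to avoid capture, whence the side
-- conditions in `sat_isZero` and `sat_isOne`.
def isZero (i : ℕ) : SOFormula := all 50 (neg (suc 50 i))
def isOne (i : ℕ) : SOFormula := ex 51 (and (isZero 51) (suc 51 i))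

def peano : SOFormula :=
  and (all 0 (ex 1 (suc 0 1))) <|
  and (all 0 (all 1 (all 2 (imp (and (suc 0 1) (suc 0 2)) (eq 1 2))))) <|
  and (all 0 (all 1 (all 2 (imp (and (suc 0 2) (suc 1 2)) (eq 0 1))))) <|
  ex 0 (and (isZero 0) (allRel 1 0 (imp (and (app₁ 0 0)
    (all 1 (all 2 (imp (and (app₁ 0 1) (suc 1 2)) (app₁ 0 2))))) (all 1 (app₁ 0 1)))))

def ltAxiom : SOFormula :=
  and (all 0 (all 1 (imp (isZero 1) (neg (lt 0 1))))) <|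
  all 0 (all 1 (all 2 (imp (suc 1 2) (iff (lt 0 2) (or (lt 0 1) (eq 0 1))))))

/-- The recursion equations of addition, denoted by `X₁³`. -/
def addAxiom : SOFormula :=
  and (all 0 (all 1 (all 2 (imp (isZero 1) (iff (app₃ 1 0 1 2) (eq 2 0)))))) <|
  all 0 (all 1 (all 2 (all 3 (imp (suc 1 2)
    (iff (app₃ 1 0 2 3) (ex 4 (and (app₃ 1 0 1 4) (suc 4 3))))))))

/-- The recursion equations of multiplication, denoted by `X₂³`. -/
def mulAxiom : SOFormula :=
  and (all 0 (all 1 (all 2 (imp (isZero 1) (iff (app₃ 2 0 1 2) (isZero 2)))))) <|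
  all 0 (all 1 (all 2 (all 3 (imp (suc 1 2)
    (iff (app₃ 2 0 2 3) (ex 4 (and (app₃ 2 0 1 4) (app₃ 1 4 0 3))))))))

def pairAxiom : SOFormula :=
  all 0 (all 1 (all 2 (iff (pair 0 1 2) (or
    (and (lt 0 1) (ex 3 (and (app₃ 2 1 1 3) (app₃ 1 3 0 2))))
    (and (neg (lt 0 1))
      (ex 3 (ex 4 (and (app₃ 2 0 0 3) (and (app₃ 1 3 0 4) (app₃ 1 4 1 2))))))))))

/-- Addition and multiplication serve only to pin down the pairing function, so they are quantified
away; successor, order and pairing remain free for the later formulas. -/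
def arith : SOFormula :=
  and peano <| and ltAxiom <| exRel 3 1 <| exRel 3 2 <| and addAxiom <| and mulAxiom pairAxiom

/-! ### Turing reducibility -/

/-- The characteristic function of `X¹` maps `vᵢ` to `vⱼ`. -/
def isChar (X i j : ℕ) : SOFormula :=
  or (and (app₁ X i) (isOne j)) (and (neg (app₁ X i)) (isZero j))

/-- The relation `X₁³` satisfies `TuringModel.Closed` for the set `X¹`. -/
def closed (X : ℕ) : SOFormula :=
  and (ex 0 (all 1 (all 2 (iff (app₃ 1 0 1 2) (isZero 2))))) <|
  and (ex 0 (all 1 (all 2 (iff (app₃ 1 0 1 2) (suc 1 2))))) <|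
  and (ex 0 (all 1 (all 2 (iff (app₃ 1 0 1 2) (ex 6 (pair 2 6 1)))))) <|
  and (ex 0 (all 1 (all 2 (iff (app₃ 1 0 1 2) (ex 5 (pair 5 2 1)))))) <|
  and (ex 0 (all 1 (all 2 (iff (app₃ 1 0 1 2) (isChar X 1 2))))) <|
  and (all 3 (all 4 (ex 0 (all 1 (all 2 (iff (app₃ 1 0 1 2)
    (ex 5 (ex 6 (and (app₃ 1 3 1 5) (and (app₃ 1 4 1 6) (pair 5 6 2)))))))))))  <|
  and (all 3 (all 4 (ex 0 (all 1 (all 2 (iff (app₃ 1 0 1 2)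
    (ex 5 (and (app₃ 1 4 1 5) (app₃ 1 3 5 2))))))))) <|
  and (all 3 (all 4 (ex 0 (and
    (all 5 (all 2 (all 11 (imp (isZero 11) (all 8 (imp (pair 5 11 8)
      (iff (app₃ 1 0 8 2) (app₃ 1 3 5 2))))))))
    (all 5 (all 1 (all 2 (all 11 (imp (suc 1 11) (all 8 (imp (pair 5 11 8)
      (iff (app₃ 1 0 8 2) (ex 7 (and (ex 9 (and (pair 5 1 9) (app₃ 1 0 9 7)))
        (ex 12 (and (pair 1 7 12) (ex 13 (and (pair 5 12 13) (app₃ 1 4 13 2))))))))))))))))))) <|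
  all 3 (ex 0 (all 5 (all 2 (iff (app₃ 1 0 5 2) (and
    (ex 8 (and (pair 5 2 8) (ex 11 (and (isZero 11) (app₃ 1 3 8 11)))))
    (all 10 (imp (lt 10 2)
      (ex 7 (and (neg (isZero 7)) (ex 8 (and (pair 5 10 8) (app₃ 1 3 8 7))))))))))))

/-- The set `X¹` is Turing reducible to `Y¹`. -/
def turingLE (X Y : ℕ) : SOFormula :=
  allRel 3 1 (imp (closed Y) (ex 0 (all 1 (all 2 (iff (app₃ 1 0 1 2) (isChar X 1 2))))))

/-! ### The structures `M_x` -/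

/-- `X₀²` is isomorphic to `M_x` for the set `x` denoted by `X₁¹`. -/
def describes : SOFormula :=
  and (all 0 (all 1 (imp (all 2 (iff (app₂ 0 2 0) (app₂ 0 2 1))) (eq 0 1)))) <|
  exRel 2 3 <| exRel 2 4 <|
  and (all 0 (all 1 (imp (isZero 0) (neg (app₂ 3 0 1))))) <|
  and (all 0 (all 3 (all 1 (imp (suc 0 3)
    (iff (app₂ 3 3 1) (all 2 (imp (app₂ 0 2 1) (app₂ 3 0 2)))))))) <|
  and (all 0 (allRel 1 5 (imp (all 2 (imp (app₁ 5 2) (app₂ 3 0 2)))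
    (ex 1 (all 2 (iff (app₂ 0 2 1) (app₁ 5 2))))))) <|
  and (all 0 (all 1 (imp (isZero 0) (iff (app₂ 4 0 1) (all 2 (neg (app₂ 0 2 1))))))) <|
  and (all 0 (all 3 (all 1 (imp (suc 0 3) (iff (app₂ 4 3 1)
    (ex 4 (and (app₂ 4 0 4) (all 2 (iff (app₂ 0 2 1) (or (app₂ 0 2 4) (eq 2 4))))))))))) <|
  and (all 1 (or (ex 0 (app₂ 3 0 1)) (exRel 1 6 (and (and (turingLE 6 1) (turingLE 1 6))
    (all 2 (iff (app₂ 0 2 1) (ex 0 (and (app₁ 6 0) (app₂ 4 0 2))))))))) <|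
  allRel 1 6 (imp (and (turingLE 6 1) (turingLE 1 6))
    (ex 1 (all 2 (iff (app₂ 0 2 1) (ex 0 (and (app₁ 6 0) (app₂ 4 0 2)))))))

/-- `X₀²` is isomorphic to `M_x` for some `x` that computes the set denoted by `X₀¹`. -/
def inCone : SOFormula := exRel 1 1 (and (turingLE 0 1) describes)

theorem freeVar_arith : arith.freeVar = ∅ := by
  have : arith.freeVarList = [] := by decide
  ext i; simp [← mem_freeVarList, this]

theorem freeRelVar_arith {p : ℕ × ℕ} (h : p ∈ arith.freeRelVar) :
    p = (2, 1) ∨ p = (2, 2) ∨ p = (3, 0) := by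
  have : ∀ p ∈ arith.freeRelVarList, p = (2, 1) ∨ p = (2, 2) ∨ p = (3, 0) := by decide
  exact this p (mem_freeRelVarList.2 h)

theorem freeVar_inCone : inCone.freeVar = ∅ := by
  have : inCone.freeVarList = [] := by decide
  ext i; simp [← mem_freeVarList, this]

set_option maxRecDepth 10000 in
theorem freeRelVar_inCone {p : ℕ × ℕ} (h : p ∈ inCone.freeRelVar) :
    p = (2, 1) ∨ p = (2, 2) ∨ p = (3, 0) ∨ p = (2, 0) ∨ p = (1, 0) := by
  have : ∀ p ∈ inCone.freeRelVarList,
      p = (2, 1) ∨ p = (2, 2) ∨ p = (3, 0) ∨ p = (2, 0) ∨ p = (1, 0) := by decide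
  exact this p (mem_freeRelVarList.2 h)

end SOFormula

/-! ### The meaning of the formulas over the natural numbers -/

/-- The relation variables `X₁²`, `X₂²`, `X₀³` have their intended meaning. -/
structure Standard (S : Rels ℕ) : Prop where
  suc : ∀ a b, S (2, 1) ![a, b] ↔ b = a + 1
  lt : ∀ a b, S (2, 2) ![a, b] ↔ a < b
  pair : ∀ a b c, S (3, 0) ![a, b, c] ↔ Nat.pair a b = c

theorem Standard.update {S : Rels ℕ} (h : Standard S) {n X : ℕ} {R : (Fin n → ℕ) → Prop}
    (h1 : (n, X) ≠ (2, 1)) (h2 : (n, X) ≠ (2, 2)) (h3 : (n, X) ≠ (3, 0)) :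
    Standard (Function.update S (n, X) R) := by
  constructor
  · rw [Function.update_of_ne h1.symm]; exact h.suc
  · rw [Function.update_of_ne h2.symm]; exact h.lt
  · rw [Function.update_of_ne h3.symm]; exact h.pair

section Standard

variable {E : ℕ → ℕ → Prop} {s : ℕ → ℕ} {S : Rels ℕ}

theorem sat_suc (h : Standard S) {i j : ℕ} :
    Sat ⟨ℕ, ⟨0⟩, E⟩ (.suc i j) s S ↔ s j = s i + 1 := by
  rw [SOFormula.suc, sat_app₂, h.suc]

theorem sat_lt (h : Standard S) {i j : ℕ} :
    Sat ⟨ℕ, ⟨0⟩, E⟩ (.lt i j) s S ↔ s i < s j := by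
  rw [SOFormula.lt, sat_app₂, h.lt]

theorem sat_pair (h : Standard S) {i j k : ℕ} :
    Sat ⟨ℕ, ⟨0⟩, E⟩ (.pair i j k) s S ↔ Nat.pair (s i) (s j) = s k := by
  rw [SOFormula.pair, sat_app₃, h.pair]

theorem sat_isZero (h : Standard S) {i : ℕ} (hi : i ≠ 50) :
    Sat ⟨ℕ, ⟨0⟩, E⟩ (.isZero i) s S ↔ s i = 0 := by
  simp only [SOFormula.isZero, sat_all, sat_neg, sat_suc h, Function.update_self,
    Function.update_of_ne hi]
  exact ⟨fun H => by_contra fun h0 => H (s i - 1) (by omega), fun H a => by omega⟩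

theorem sat_isOne (h : Standard S) {i : ℕ} (hi : i ≠ 51) :
    Sat ⟨ℕ, ⟨0⟩, E⟩ (.isOne i) s S ↔ s i = 1 := by
  simp [SOFormula.isOne, sat_ex, sat_and, sat_suc h, sat_isZero h, Function.update_of_ne hi]

theorem sat_isChar (h : Standard S) {X i j : ℕ} (hi : j ≠ 50) (hi' : j ≠ 51) :
    Sat ⟨ℕ, ⟨0⟩, E⟩ (.isChar X i j) s S ↔
      (s i ∈ {a | S (1, X) ![a]} ∧ s j = 1) ∨ (s i ∉ {a | S (1, X) ![a]} ∧ s j = 0) := by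
  simp [SOFormula.isChar, sat_or, sat_and, sat_neg, sat_app₁, sat_isZero h hi, sat_isOne h hi']

theorem sat_closed (h : Standard S) {X : ℕ} : Sat ⟨ℕ, ⟨0⟩, E⟩ (.closed X) s S ↔
    TuringModel.Closed (fun k n m => S (3, 1) ![k, n, m]) {a | S (1, X) ![a]} := by
  simp only [SOFormula.closed, TuringModel.Closed, sat_and]
  refine and_congr ?_ <| and_congr ?_ <| and_congr ?_ <| and_congr ?_ <| and_congr ?_ <|
    and_congr ?_ <| and_congr ?_ <| and_congr ?_ ?_
  all_goals simp [sat_all, sat_ex, sat_and, sat_iff, sat_imp, sat_neg, sat_app₃, sat_suc h,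
      sat_lt h, sat_pair h, sat_isZero h, sat_isChar h, Function.update_of_ne]

theorem sat_turingLE (h : Standard S) {X Y : ℕ} : Sat ⟨ℕ, ⟨0⟩, E⟩ (.turingLE X Y) s S ↔
    TuringModel.TuringLE {a | S (1, X) ![a]} {a | S (1, Y) ![a]} := by
  have h' (R) : Standard (Function.update S (3, 1) R) := h.update (by simp) (by simp) (by simp)
  simp only [SOFormula.turingLE, sat_allRel, sat_imp, sat_closed (h' _),
    TuringModel.turingLE_iff_forall_closed]
  rw [forall_rel₃]
  refine forall_congr' fun W => ?_
  simp [sat_all, sat_ex, sat_iff, sat_app₃, sat_isChar (h' _)]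

theorem sat_describes (h : Standard S) : Sat ⟨ℕ, ⟨0⟩, E⟩ .describes s S ↔
    TuringModel.Describes {a | S (1, 1) ![a]} fun b a => S (2, 0) ![b, a] := by
  simp only [SOFormula.describes, TuringModel.Describes, sat_and, sat_exRel]
  refine and_congr ?_ ?_
  · simp [sat_all, sat_imp, sat_iff, sat_app₂, sat_eq]
  rw [exists_rel₂]
  refine exists_congr fun U => ?_
  rw [exists_rel₂]
  refine exists_congr fun W => ?_
  have hS := (h.update (n := 2) (X := 3) (R := fun w => U (w 0) (w 1)) (by simp) (by simp)
    (by simp)).update (n := 2) (X := 4) (R := fun w => W (w 0) (w 1)) (by simp) (by simp) (by simp)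
  have hS' (R) := hS.update (n := 1) (X := 6) (R := R) (by simp) (by simp) (by simp)
  refine and_congr ?_ <| and_congr ?_ <| and_congr ?_ <| and_congr ?_ <| and_congr ?_ <|
    and_congr ?_ ?_
  · simp [sat_all, sat_imp, sat_neg, sat_app₂, sat_isZero hS]
    exact ⟨fun h a => h _ _ rfl, by rintro h _ a rfl; exact h a⟩
  · simp [sat_all, sat_imp, sat_iff, sat_app₂, sat_suc hS]
    exact ⟨fun h n a => h _ _ _ rfl, by rintro h n _ a rfl; exact h n a⟩
  · simp [sat_all, sat_ex, sat_imp, sat_iff, sat_app₁, sat_app₂, sat_allRel, forall_rel₁]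
    rfl
  · simp [sat_all, sat_imp, sat_iff, sat_neg, sat_app₂, sat_isZero hS]
    exact ⟨fun h a => h _ _ rfl, by rintro h _ a rfl; exact h a⟩
  · simp [sat_all, sat_ex, sat_and, sat_or, sat_imp, sat_iff, sat_eq, sat_app₂, sat_suc hS]
    exact ⟨fun h n a => h _ _ _ rfl, by rintro h n _ a rfl; exact h n a⟩
  · simp [sat_all, sat_ex, sat_and, sat_or, sat_iff, sat_exRel, sat_app₁, sat_app₂,
      sat_turingLE (hS' _), exists_rel₁, TuringModel.TuringEq]
  · rw [sat_allRel, forall_rel₁]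
    simp [sat_all, sat_ex, sat_and, sat_imp, sat_iff, sat_app₁, sat_app₂,
      sat_turingLE (hS' _), TuringModel.TuringEq]

theorem sat_inCone (h : Standard S) : Sat ⟨ℕ, ⟨0⟩, E⟩ .inCone s S ↔
    ∃ x, TuringModel.TuringLE {a | S (1, 0) ![a]} x ∧
      BinStr.Iso ⟨ℕ, ⟨0⟩, fun b a => S (2, 0) ![b, a]⟩ (TuringModel.model x) := by
  have h' (R) : Standard (Function.update S (1, 1) R) := h.update (by simp) (by simp) (by simp)
  simp only [SOFormula.inCone, sat_exRel, sat_and, sat_turingLE (h' _), sat_describes (h' _),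
    TuringModel.describes_iff_iso]
  rw [exists_rel₁]
  refine exists_congr fun W => ?_
  simp

theorem sat_arith (h : Standard S) : Sat ⟨ℕ, ⟨0⟩, E⟩ .arith s S := by
  have h' (R R') := (h.update (n := 3) (X := 1) (R := R) (by simp) (by simp) (by simp)).update
    (n := 3) (X := 2) (R := R') (by simp) (by simp) (by simp)
  have h'' (R) := h.update (n := 1) (X := 0) (R := R) (by simp) (by simp) (by simp)
  rw [SOFormula.arith, sat_and, sat_and, sat_exRel]
  refine ⟨?_, ?_, fun w => w 0 + w 1 = w 2, sat_exRel.2 ⟨fun w => w 0 * w 1 = w 2, ?_⟩⟩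
  · simp only [SOFormula.peano, sat_and, sat_all, sat_ex, sat_imp, sat_suc h, sat_eq,
      sat_isZero h (show 0 ≠ 50 by simp), sat_allRel, forall_rel₁, sat_suc (h'' _), sat_app₁]
    simp
    intro W h0 hs a
    induction a with
    | zero => exact h0
    | succ a ih => exact hs a ih
  · simp [SOFormula.ltAxiom, sat_and, sat_all, sat_imp, sat_iff, sat_or, sat_neg, sat_suc h,
      sat_eq, sat_isZero h, sat_lt h]
    exact fun a b => le_iff_lt_or_eq
  · have hadd : ∀ a b c, Function.update (Function.update S (3, 1) fun w => w 0 + w 1 = w 2) (3, 2)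
        (fun w => w 0 * w 1 = w 2) (3, 1) ![a, b, c] ↔ a + b = c := by simp
    have hmul : ∀ a b c, Function.update (Function.update S (3, 1) fun w => w 0 + w 1 = w 2) (3, 2)
        (fun w => w 0 * w 1 = w 2) (3, 2) ![a, b, c] ↔ a * b = c := by simp
    refine ⟨?_, ?_, ?_⟩
    · simp [SOFormula.addAxiom, sat_and, sat_all, sat_ex, sat_imp, sat_iff, sat_app₃, sat_eq,
        sat_suc (h' _ _), sat_isZero (h' _ _), hadd, eq_comm, add_assoc]
      exact ⟨by rintro a _ c rfl; simp [eq_comm], by rintro a b _ d rfl; rfl⟩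
    · simp [SOFormula.mulAxiom, sat_and, sat_all, sat_ex, sat_imp, sat_iff, sat_app₃,
        sat_suc (h' _ _), sat_isZero (h' _ _), hadd, hmul, eq_comm]
      exact ⟨by rintro a _ c rfl; simp, by rintro a b _ d rfl; rw [mul_add_one]⟩
    · simp [SOFormula.pairAxiom, sat_and, sat_all, sat_ex, sat_neg, sat_or, sat_iff, sat_app₃,
        sat_lt (h' _ _), sat_pair (h' _ _), hadd, hmul]
      intro a b c
      unfold Nat.pair
      split_ifs <;> omega

end Standard

/-! ### Categoricity of second order arithmetic -/

section Arith

variable {M : BinStr.{u}} {s : ℕ → M.carrier} {S : Rels M.carrier}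

theorem sat_isZero_iff {i : ℕ} (hi : i ≠ 50) :
    Sat M (.isZero i) s S ↔ ∀ a, ¬ S (2, 1) ![a, s i] := by
  simp [SOFormula.isZero, SOFormula.suc, sat_all, sat_neg, sat_app₂, Function.update_of_ne hi]

/-- Dedekind's theorem: iterating the successor from zero gives `g`. It is injective because the
successor is injective and misses zero, and surjective by second order induction applied to its
range. -/
theorem exists_numbering_of_sat_peano (h : Sat M .peano s S) :
    ∃ g : ℕ → M.carrier, Function.Bijective g ∧ (∀ a b, S (2, 1) ![g a, b] ↔ b = g (a + 1)) ∧
      ∀ a, ¬ S (2, 1) ![a, g 0] := by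
  simp only [SOFormula.peano, SOFormula.suc, sat_and, sat_all, sat_ex, sat_imp, sat_app₁, sat_app₂,
    sat_eq, sat_isZero_iff (show 0 ≠ 50 by simp), sat_allRel, forall_rel₁] at h
  simp at h
  obtain ⟨htot, hfun, hinj, z, hz, hind⟩ := h
  choose f hf using htot
  have hf' (a b) : S (2, 1) ![a, b] ↔ b = f a :=
    ⟨fun h => hfun a b (f a) h (hf a), fun h => h ▸ hf a⟩
  let g : ℕ → M.carrier := fun n => Nat.rec z (fun _ => f) n
  have fz (a) : f a ≠ z := fun h => hz a (h ▸ hf a)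
  have finj : Function.Injective f := fun a b h => hinj a b (f a) (hf a) (h ▸ hf b)
  refine ⟨g, ⟨fun m => ?_, fun a => ?_⟩, fun a b => hf' _ _, hz⟩
  · induction m with
    | zero =>
      rintro (_ | n) h
      · rfl
      · exact (fz (g n) h.symm).elim
    | succ m ih =>
      rintro (_ | n) h
      · exact (fz (g m) h).elim
      · exact congrArg (· + 1) (ih (finj h))
  · refine hind (Set.range g) ⟨0, rfl⟩ ?_ a
    rintro _ b ⟨n, rfl⟩ hb
    exact ⟨n + 1, ((hf' _ _).1 hb).symm⟩

/-- The recursion equations determine order, addition and multiplication by induction on the second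
argument, and these determine pairing. -/
theorem exists_equiv_of_sat_arith (h : Sat M .arith s S) :
    ∃ e : M.carrier ≃ ℕ, Standard fun p w => S p fun k => e.symm (w k) := by
  simp only [SOFormula.arith, sat_and, sat_exRel] at h
  obtain ⟨hp, hl, A, B, ha, hm, hpair⟩ := h
  obtain ⟨g, hg, hs, hz⟩ := exists_numbering_of_sat_peano hp
  have hs' (a b) : S (2, 1) ![g a, g b] ↔ b = a + 1 := (hs a _).trans hg.1.eq_iff
  have hz' {x} (hx : ∀ a, ¬ S (2, 1) ![a, x]) : x = g 0 := by
    obtain ⟨_ | n, rfl⟩ := hg.2 x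
    · rfl
    · exact (hx (g n) ((hs' _ _).2 rfl)).elim
  simp [SOFormula.ltAxiom, SOFormula.suc, SOFormula.lt, sat_and, sat_all, sat_imp, sat_iff, sat_or,
    sat_neg, sat_app₂, sat_eq, sat_isZero_iff] at hl
  simp [SOFormula.addAxiom, SOFormula.suc, sat_and, sat_all, sat_ex, sat_imp, sat_iff, sat_app₂,
    sat_app₃, sat_eq, sat_isZero_iff] at ha
  simp [SOFormula.mulAxiom, SOFormula.suc, sat_and, sat_all, sat_ex, sat_imp, sat_iff, sat_app₂,
    sat_app₃, sat_isZero_iff] at hm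
  simp [SOFormula.pairAxiom, SOFormula.lt, SOFormula.pair, sat_and, sat_all, sat_ex, sat_neg,
    sat_or, sat_iff, sat_app₂, sat_app₃] at hpair
  have hlt : ∀ b a, S (2, 2) ![g a, g b] ↔ a < b := by
    intro b
    induction b with
    | zero => exact fun a => iff_of_false (hl.1 _ _ hz) (Nat.not_lt_zero a)
    | succ b ih =>
      intro a
      rw [hl.2 _ _ _ ((hs' b _).2 rfl), ih, hg.1.eq_iff]
      omega
  have hadd : ∀ b a c, A ![g a, g b, c] ↔ c = g (a + b) := by
    intro b
    induction b with
    | zero => exact fun a c => ha.1 _ _ _ hz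
    | succ b ih =>
      intro a c
      rw [ha.2 _ _ _ _ ((hs' b _).2 rfl)]
      simp only [ih, exists_eq_left, hs]
      rfl
  have hmul : ∀ b a c, B ![g a, g b, c] ↔ c = g (a * b) := by
    intro b
    induction b with
    | zero => exact fun a c => (hm.1 _ _ _ hz).trans ⟨hz', fun h => h ▸ hz⟩
    | succ b ih =>
      intro a c
      rw [hm.2 _ _ _ _ ((hs' b _).2 rfl)]
      simp only [ih, exists_eq_left, hadd]
      rfl
  have hpr (a b c) : S (3, 0) ![g a, g b, g c] ↔ Nat.pair a b = c := by
    rw [hpair]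
    simp only [hlt, hmul, exists_eq_left, hadd, hg.1.eq_iff]
    unfold Nat.pair
    by_cases h : a < b <;> simp [h, eq_comm]
  let e := (Equiv.ofBijective g hg).symm
  refine ⟨e, fun a b => ?_, fun a b => ?_, fun a b c => ?_⟩
  · rw [show (fun k => e.symm (![a, b] k)) = ![g a, g b] from List.ofFn_inj.1 rfl]
    exact hs' a b
  · rw [show (fun k => e.symm (![a, b] k)) = ![g a, g b] from List.ofFn_inj.1 rfl]
    exact hlt b a
  · rw [show (fun k => e.symm (![a, b, c] k)) = ![g a, g b, g c] from List.ofFn_inj.1 rfl]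
    exact hpr a b c

end Arith

end SecondOrder

namespace SecondOrder

open TuringModel SOFormula

/-! ### Properties of structures expressed by `SOFormula.unary` -/

/-- The structure `M` has the property expressed by the `k`-th formula `SOFormula.unary k`. -/
def Holds (M : BinStr.{u}) (k : ℕ) : Prop :=
  ∀ s S, S (2, 0) = (fun w => M.rel (w 0) (w 1)) → Sat M (unary k) s S

/-- The formula neither mentions `E` nor has a free variable other than `X₀²`, so its truth depends
only on the relation that `X₀²` denotes. -/
theorem sat_unary {A : Type u} {hA : Nonempty A} {E : A → A → Prop} {k : ℕ} {s : ℕ → A}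
    {S : Rels A} :
    Sat ⟨A, hA, E⟩ (unary k) s S ↔ Holds ⟨A, hA, fun a b => S (2, 0) ![a, b]⟩ k := by
  rw [sat_of_memFree (memFree_unary k) (E' := fun a b => S (2, 0) ![a, b])]
  have hS : S (2, 0) = fun w => S (2, 0) ![w 0, w 1] :=
    funext fun w => congrArg (S (2, 0)) (List.ofFn_inj.1 rfl)
  refine ⟨fun h s' S' h' => (sat_congr _ _ ?_ ?_).1 h, fun h => h s S hS⟩
  · simp [freeVar_unary]
  · intro p hp
    obtain rfl := freeRelVar_unary k hp
    exact hS.trans h'.symm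

theorem holds_of_iso {M : BinStr.{u}} {N : BinStr.{v}} {k : ℕ} (e : M.Iso N) (h : Holds M k) :
    Holds N k := by
  obtain ⟨e⟩ := e
  intro s S hS
  refine (sat_iso e.symm _ s S).2 (h _ _ ?_)
  funext w
  rw [hS]
  exact propext e.map_rel_iff

theorem sat_closeVar_iff {M : BinStr.{u}} {φ : SOFormula} {Q : ((Fin 2 → M.carrier) → Prop) → Prop}
    (h : ∀ s S, Sat M φ s S ↔ Q (S (2, 0))) (m : ℕ) (s : ℕ → M.carrier) (S : Rels M.carrier) :
    Sat M (closeVar φ m) s S ↔ Q (S (2, 0)) := by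
  induction m generalizing s with
  | zero => exact h s S
  | succ m ih =>
    have := M.nonempty
    simp [closeVar, sat_all, ih]

theorem sat_closeRel_iff {M : BinStr.{u}} {φ : SOFormula} {Q : ((Fin 2 → M.carrier) → Prop) → Prop}
    (h : ∀ s S, Sat M φ s S ↔ Q (S (2, 0))) (m : ℕ) (s : ℕ → M.carrier) (S : Rels M.carrier) :
    Sat M (closeRel φ m) s S ↔ Q (S (2, 0)) := by
  induction m generalizing S with
  | zero => exact h s S
  | succ m ih => simp [closeRel, sat_allRel, ih]

/-- For a sentence `φ` the closing quantifiers of `unary φ.code` are vacuous, so what is left is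
`φ.relativize`. Hence every sentence occurs in the enumeration. -/
theorem holds_code {M : BinStr.{u}} {φ : SOFormula} (hφ : φ.IsSentence) :
    Holds M φ.code ↔ Models M φ := by
  obtain ⟨A, hA, E⟩ := M
  have h1 (s S) : Sat ⟨A, hA, E⟩ (ofCode φ.code) s S ↔
      Models ⟨A, hA, fun a b => S (2, 0) ![a, b]⟩ φ := by
    rw [ofCode_code, sat_relativize, models_iff_of_isSentence hφ]
  let Q (R : (Fin 2 → A) → Prop) : Prop := Models ⟨A, hA, fun a b => R ![a, b]⟩ φ
  have h2 (s S) : Sat ⟨A, hA, E⟩ (unary φ.code) s S ↔ Q (S (2, 0)) :=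
    sat_closeRel_iff (M := ⟨A, hA, E⟩) (Q := Q)
      (sat_closeVar_iff (M := ⟨A, hA, E⟩) (Q := Q) h1 _) _ s S
  simp only [Holds, h2]
  obtain ⟨a⟩ := hA
  constructor
  · intro h
    exact h (fun _ => a) (Function.update (fun _ _ => True) (2, 0) fun w => E (w 0) (w 1))
      (by simp)
  · intro h s S hS
    rw [hS]
    exact h

/-! ### The theory -/

/-- Given that `a` axiomatizes arithmetic and `c` says that `X₀²` is isomorphic to `M_x` for some
`x` that computes `X₀¹`, this says that if `ψ` holds on a cone, then `ψ` holds of `E`. -/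
def coneAxiom (a c ψ : SOFormula) : SOFormula :=
  exRel 2 1 <| exRel 2 2 <| exRel 3 0 <| and a <|
    imp (exRel 1 0 (allRel 2 0 (imp c ψ)))
      (allRel 2 0 (imp (all 0 (all 1 (iff (app₂ 0 0 1) (mem 0 1)))) ψ))

/-- The properties that hold on a cone hold. -/
def coneTheory : Set SOFormula := Set.range fun k => coneAxiom arith inCone (unary k)

theorem isSentence_coneAxiom (k : ℕ) : (coneAxiom arith inCone (unary k)).IsSentence := by
  constructor
  · ext i
    simp [coneAxiom, exRel, imp, iff, app₂, freeVar, freeVar_arith, freeVar_inCone, freeVar_unary]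
  · ext p
    have h1 := @freeRelVar_arith p
    have h2 := @freeRelVar_inCone p
    have h3 := @freeRelVar_unary k p
    simp only [coneAxiom, exRel, imp, iff, app₂, freeRelVar, Set.mem_sdiff, Set.mem_union,
      Set.mem_singleton_iff, Set.mem_empty_iff_false] at *
    tauto

theorem isTheory_coneTheory : IsTheory coneTheory := by
  rintro _ ⟨k, rfl⟩
  exact isSentence_coneAxiom k

/-- The formulas `a` and `c` enter only through their constant codes, and `unary k` is the only part
that varies. -/
theorem primrec_code_coneAxiom (a c : SOFormula) :
    Primrec fun k => (coneAxiom a c (unary k)).code := by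
  have pr {f g : ℕ → ℕ} (hf : Primrec f) (hg : Primrec g) :
      Primrec fun k => Nat.pair (f k) (g k) := Primrec₂.natPair.comp hf hg
  have const (i : ℕ) : Primrec fun _ : ℕ => i := Primrec.const i
  have hneg {f : ℕ → SOFormula} (hf : Primrec fun k => (f k).code) :
      Primrec fun k => (f k).neg.code := pr (const 3) hf
  have hand {f g : ℕ → SOFormula} (hf : Primrec fun k => (f k).code)
      (hg : Primrec fun k => (g k).code) : Primrec fun k => ((f k).and (g k)).code :=
    pr (const 4) (pr hf hg)
  have hall (n X : ℕ) {f : ℕ → SOFormula} (hf : Primrec fun k => (f k).code) :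
      Primrec fun k => (allRel n X (f k)).code := pr (const 6) (pr (const n) (pr (const X) hf))
  have hc (φ : SOFormula) : Primrec fun _ : ℕ => φ.code := const _
  have himp {f g : ℕ → SOFormula} (hf : Primrec fun k => (f k).code)
      (hg : Primrec fun k => (g k).code) : Primrec fun k => ((f k).imp (g k)).code :=
    hneg (hand hf (hneg hg))
  have hex (n X : ℕ) {f : ℕ → SOFormula} (hf : Primrec fun k => (f k).code) :
      Primrec fun k => (exRel n X (f k)).code := hneg (hall n X (hneg hf))
  exact hex _ _ <| hex _ _ <| hex _ _ <| hand (hc a) <|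
    himp (hex _ _ (hall _ _ (himp (hc c) primrec_code_unary)))
      (hall _ _ (himp (hc _) primrec_code_unary))

theorem le_code_coneAxiom (a c : SOFormula) (k : ℕ) : k ≤ (coneAxiom a c (unary k)).code := by
  refine (le_code_unary k).trans ?_
  have hneg (φ : SOFormula) : φ.code ≤ φ.neg.code := Nat.right_le_pair _ _
  have hand₁ (φ ψ : SOFormula) : φ.code ≤ (φ.and ψ).code :=
    (Nat.left_le_pair _ _).trans (Nat.right_le_pair _ _)
  have hand₂ (φ ψ : SOFormula) : ψ.code ≤ (φ.and ψ).code :=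
    (Nat.right_le_pair _ _).trans (Nat.right_le_pair _ _)
  have hall (n X : ℕ) (φ : SOFormula) : φ.code ≤ (allRel n X φ).code :=
    (Nat.right_le_pair _ _).trans ((Nat.right_le_pair _ _).trans (Nat.right_le_pair _ _))
  have himp (φ ψ : SOFormula) : ψ.code ≤ (φ.imp ψ).code :=
    (hneg ψ).trans ((hand₂ φ _).trans (hneg _))
  have hex (n X : ℕ) (φ : SOFormula) : φ.code ≤ (exRel n X φ).code :=
    (hneg φ).trans ((hall n X _).trans (hneg _))
  exact (himp _ _).trans <| (hall _ _ _).trans <| (himp _ _).trans <| (hand₂ _ _).trans <|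
    (hex _ _ _).trans <| (hex _ _ _).trans (hex _ _ _)

theorem isRecursive_coneTheory : IsRecursive coneTheory := by
  have h1 : PrimrecRel fun k n => (coneAxiom arith inCone (unary k)).code = n :=
    Primrec.eq.comp ((primrec_code_coneAxiom _ _).comp Primrec.fst) Primrec.snd
  -- The code of the `k`-th axiom is at least `k`, so a bounded search decides membership.
  have h2 : PrimrecPred fun n => ∃ k < n + 1, (coneAxiom arith inCone (unary k)).code = n :=
    h1.exists_lt.comp Primrec.succ Primrec.id
  have h3 : (fun n => ∃ φ ∈ coneTheory, φ.code = n) =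
      fun n => ∃ k < n + 1, (coneAxiom arith inCone (unary k)).code = n := by
    funext n
    simp only [coneTheory, Set.mem_range, exists_exists_eq_and, eq_iff_iff]
    exact exists_congr fun k => ⟨fun h => ⟨Nat.lt_succ_of_le (h ▸ le_code_coneAxiom _ _ k), h⟩,
      fun h => h.2⟩
  rw [IsRecursive, h3]
  obtain ⟨_, h⟩ := h2
  exact ⟨_, h.to_comp⟩

/-- The `k`-th property holds of `M_x` for a cone of `x`. -/
def HoldsOnCone (k : ℕ) : Prop := ∃ z, ∀ x, TuringLE z x → Holds (model x) k

/-- Over `ℕ` the set quantifiers range over all possible cone bases, and each countably infinite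
`M_x` has a copy on `ℕ`. The formula therefore expresses actual truth on a cone, whatever `E` is. -/
theorem sat_cone {E : ℕ → ℕ → Prop} {s : ℕ → ℕ} {S : Rels ℕ} (h : Standard S) (k : ℕ) :
    Sat ⟨ℕ, ⟨0⟩, E⟩ (exRel 1 0 (allRel 2 0 (imp inCone (unary k)))) s S ↔ HoldsOnCone k := by
  have h' (R R') : Standard (Function.update (Function.update S (1, 0) R) (2, 0) R') :=
    (h.update (by simp) (by simp) (by simp)).update (by simp) (by simp) (by simp)
  simp only [sat_exRel, sat_allRel, sat_imp, sat_inCone (h' _ _), sat_unary, exists_rel₁,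
    forall_rel₂, HoldsOnCone]
  refine exists_congr fun z => ?_
  simp only [Function.update_self, ne_eq, Prod.mk.injEq, OfNat.one_ne_ofNat, false_and,
    not_false_eq_true, Function.update_of_ne, Matrix.cons_val_zero, Matrix.cons_val_one,
    Set.ofPred_mem_eq]
  constructor
  · intro H x hx
    obtain ⟨Y, hY⟩ := exists_nat_iso (M := model x)
    exact holds_of_iso hY.symm (H Y ⟨x, hx, hY.symm⟩)
  · rintro H Y ⟨x, hx, hY⟩
    exact holds_of_iso hY.symm (H x hx)

theorem sat_forall_eq_mem {M : BinStr.{u}} {s : ℕ → M.carrier} {S : Rels M.carrier} (k : ℕ) :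
    Sat M (allRel 2 0 (imp (all 0 (all 1 (iff (app₂ 0 0 1) (mem 0 1)))) (unary k))) s S ↔
      Holds M k := by
  obtain ⟨A, hA, E⟩ := M
  simp only [sat_allRel, forall_rel₂, sat_imp, sat_all, sat_iff, sat_app₂, sat_mem, sat_unary]
  simp
  refine ⟨fun H => H E fun _ _ => Iff.rfl, fun H W hW => ?_⟩
  obtain rfl : W = E := funext fun a => funext fun b => propext (hW a b)
  exact H

theorem sat_equiv {M : BinStr.{u}} (e : M.carrier ≃ ℕ) (φ : SOFormula) (s : ℕ → M.carrier)
    (S : Rels M.carrier) : Sat M φ s S ↔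
      Sat ⟨ℕ, ⟨0⟩, fun a b => M.rel (e.symm a) (e.symm b)⟩ φ (fun i => e (s i))
        fun p w => S p fun k => e.symm (w k) :=
  sat_iso (N := ⟨ℕ, ⟨0⟩, fun a b => M.rel (e.symm a) (e.symm b)⟩) ⟨e, by simp⟩ φ s S

/-- Any domain satisfying `arith` is in bijection with `ℕ`; transporting along the bijection gives
the premise its actual truth value. -/
theorem models_coneAxiom {M : BinStr.{u}} {k : ℕ} :
    Models M (coneAxiom arith inCone (unary k)) ↔
      Nonempty (M.carrier ≃ ℕ) ∧ (HoldsOnCone k → Holds M k) := by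
  obtain ⟨a₀⟩ := M.nonempty
  rw [models_iff_of_isSentence (isSentence_coneAxiom k) (fun _ => a₀) fun _ _ => True]
  constructor
  · intro h
    obtain ⟨R₁, h⟩ := sat_exRel.1 h
    obtain ⟨R₂, h⟩ := sat_exRel.1 h
    obtain ⟨R₃, h⟩ := sat_exRel.1 h
    obtain ⟨ha, h⟩ := sat_and.1 h
    rw [sat_imp, sat_forall_eq_mem] at h
    obtain ⟨e, he⟩ := exists_equiv_of_sat_arith ha
    exact ⟨⟨e⟩, fun hk => h ((sat_equiv e _ _ _).2 ((sat_cone he k).2 hk))⟩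
  · rintro ⟨⟨e⟩, h⟩
    refine sat_exRel.2 ⟨fun w => e (w 1) = e (w 0) + 1, sat_exRel.2 ⟨fun w => e (w 0) < e (w 1),
      sat_exRel.2 ⟨fun w => Nat.pair (e (w 0)) (e (w 1)) = e (w 2), ?_⟩⟩⟩
    set S : Rels M.carrier := Function.update (Function.update (Function.update _ _ _) _ _) _ _
      with hS
    have he : Standard fun p w => S p fun k => e.symm (w k) := by
      constructor <;> simp [hS]
    refine sat_and.2 ⟨(sat_equiv e _ _ _).2 (sat_arith he), ?_⟩
    rw [sat_imp, sat_forall_eq_mem]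
    exact fun hc => h ((sat_cone he k).1 ((sat_equiv e _ _ _).1 hc))

theorem modelsTheory_coneTheory {M : BinStr.{u}} : ModelsTheory M coneTheory ↔
    Nonempty (M.carrier ≃ ℕ) ∧ ∀ k, HoldsOnCone k → Holds M k := by
  simp only [ModelsTheory, coneTheory, Set.forall_mem_range, models_coneAxiom]
  exact ⟨fun h => ⟨(h 0).1, fun k => (h k).2⟩, fun h k => ⟨h.1, h.2 k⟩⟩

theorem modelsTheory_of_iso {M : BinStr.{u}} {N : BinStr.{v}} {T : Set SOFormula} (e : M.Iso N)
    (h : ModelsTheory M T) : ModelsTheory N T :=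
  fun φ hφ => models_iso e (h φ hφ)

theorem exists_cone_modelsTheory :
    ∃ z, ∀ x, TuringLE z x → ModelsTheory (model x) coneTheory := by
  have h (k) : ∃ z, HoldsOnCone k → ∀ x, TuringLE z x → Holds (model x) k := by
    -- Bases are chosen for all `k`; the value is irrelevant for properties that hold on no cone.
    -- The join of the bases then works for all axioms at once.
    by_cases hk : HoldsOnCone k
    · exact hk.imp fun z hz _ => hz
    · exact ⟨∅, fun h => (hk h).elim⟩
  choose z hz using h
  obtain ⟨y, hy⟩ := exists_upper_bound z
  refine ⟨y, fun x hx => modelsTheory_coneTheory.2 ⟨?_, fun k hk => hz k hk x ((hy k).trans hx)⟩⟩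
  obtain ⟨_⟩ := nonempty_denumerable (model x).carrier
  exact ⟨Denumerable.eqv _⟩

/-! ### Completeness -/

open Projective

theorem determined_holds (hPD : PD) (k : ℕ) :
    Determined {p | graphSet p ∈ {x | Holds (model x) k}} := by
  -- `F` codes the standard arithmetic relations and stays fixed, while only the set denoted by
  -- `X₁¹` varies with the play.
  obtain ⟨F, hF⟩ := exists_code_rels
    (Function.update (Function.update (Function.update (fun _ _ => True)
      (2, 1) fun w => w 1 = w 0 + 1) (2, 2) fun w => w 0 < w 1)
      (3, 0) fun w => Nat.pair (w 0) (w 1) = w 2)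
  have hstd : Standard (decodeRels F) := by
    rw [← hF]
    constructor <;> simp
  -- `G p` codes the graph of `p` as a unary relation, with 0 meaning true; the argument is the head
  -- of a coded one-element list. Each coordinate depends on a single value of `p`, which gives
  -- continuity.
  let G (p : ℕ → ℕ) (j : ℕ) : ℕ :=
    if p ((Denumerable.ofNat (List ℕ) j).headI).unpair.1 =
      ((Denumerable.ofNat (List ℕ) j).headI).unpair.2 then 0 else 1
  have hG : Continuous G := continuous_pi fun j =>
    (continuous_of_discreteTopology (f := fun m =>
      if m = ((Denumerable.ofNat (List ℕ) j).headI).unpair.2 then 0 else 1)).comp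
      (continuous_apply _)
  have hFG : Continuous fun p => setRel 1 1 F (G p) := by
    refine continuous_pi fun j => ?_
    unfold setRel
    split_ifs <;> fun_prop
  refine hPD _ ?_
  -- The formula says that some relation isomorphic to `M_x` has the property. It does not use `E`,
  -- so an arbitrary interpretation will do.
  convert isProjective_sat (fun _ _ => False) (exRel 2 0 (and describes (unary k)))
    (fun _ => 0) hFG using 1
  ext p
  have h' (R) : Standard (Function.update (decodeRels (setRel 1 1 F (G p))) (2, 0) R) := by
    rw [decodeRels_setRel]
    exact (hstd.update (by simp) (by simp) (by simp)).update (by simp) (by simp) (by simp)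
  have hp (a : ℕ) : decodeRels (setRel 1 1 F (G p)) (1, 1) ![a] ↔ a ∈ graphSet p := by
    rw [decodeRels_setRel, Function.update_self]
    simp [G, graphSet]
  simp only [Set.mem_ofPred_eq, sat_exRel, sat_and, sat_describes (h' _), sat_unary, exists_rel₂,
    describes_iff_iso]
  simp [hp]
  constructor
  · intro H
    obtain ⟨Y, hY⟩ := exists_nat_iso (M := model (graphSet p))
    exact ⟨Y, hY.symm, holds_of_iso hY H⟩
  · rintro ⟨Y, hY, H⟩
    exact holds_of_iso hY H

theorem holdsOnCone_or (hPD : PD) {φ : SOFormula} (hφ : φ.IsSentence) :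
    HoldsOnCone φ.code ∨ HoldsOnCone φ.neg.code := by
  have hφ' : φ.neg.IsSentence := hφ
  refine (cone_or_cone {x | Holds (model x) φ.code} (fun x y h =>
    holds_of_iso (model_iso_of_turingEq h)) (determined_holds hPD _)).imp_right ?_
  refine Exists.imp fun z hz x hx => ?_
  rw [holds_code hφ', models_neg_iff hφ, ← holds_code hφ]
  exact hz x hx

theorem isComplete_coneTheory (hPD : PD) : IsComplete.{u} coneTheory := by
  intro φ hφ
  have hφ' : φ.neg.IsSentence := hφ
  exact (holdsOnCone_or hPD hφ).imp
    (fun h M hM => (holds_code hφ).1 ((modelsTheory_coneTheory.1 hM).2 _ h))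
    (fun h M hM => (holds_code hφ').1 ((modelsTheory_coneTheory.1 hM).2 _ h))

/-! ### The number of countable models -/

theorem numCountableModels_coneTheory_le :
    numCountableModels.{u} coneTheory ≤ Cardinal.continuum.{u + 1} := by
  have h (q : Quotient (countableModelSetoid.{u} coneTheory)) :
      ∃ Y : Set ℕ, q.out.1.Iso ⟨ℕ, ⟨0⟩, fun a b => Nat.pair a b ∈ Y⟩ := by
    obtain ⟨e⟩ := (modelsTheory_coneTheory.1 q.out.2.2).1
    refine ⟨{c | q.out.1.rel (e.symm c.unpair.1) (e.symm c.unpair.2)}, ⟨⟨e, by simp⟩⟩⟩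
  choose Y hY using h
  have hinj : Function.Injective Y := fun q q' hq => by
    have h1 : q.out.1.Iso q'.out.1 := (hY q).trans (hq ▸ (hY q').symm)
    rw [← Quotient.out_eq q, ← Quotient.out_eq q']
    exact Quotient.sound h1
  simpa [numCountableModels] using Cardinal.lift_mk_le_lift_mk_of_injective hinj

/-- Sending `x` to the isomorphism type of `M_{f x}` has countable fibres, since isomorphic
structures come from Turing equivalent sets. A domain of size continuum then needs continuum many
types. -/
theorem le_numCountableModels_coneTheory :
    Cardinal.continuum.{u + 1} ≤ numCountableModels.{u} coneTheory := by
  obtain ⟨z, hz⟩ := exists_cone_modelsTheory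
  obtain ⟨f, hf, hzf⟩ := exists_injective_cone z
  have h (x : Set ℕ) : ∃ M : {M : BinStr.{u} // Countable M.carrier ∧ ModelsTheory M coneTheory},
      (model (f x)).Iso M.1 := by
    obtain ⟨Y, e⟩ := exists_nat_iso (M := model (f x))
    -- `model` lives in `Type 1`; a copy on `ULift ℕ` brings it into the universe in which models
    -- are counted.
    have e' : BinStr.Iso ⟨ℕ, ⟨0⟩, Y⟩ (⟨ULift.{u} ℕ, ⟨⟨0⟩⟩, fun a b => Y a.down b.down⟩ : BinStr.{u}) :=
      ⟨⟨Equiv.ulift.symm, Iff.rfl⟩⟩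
    exact ⟨⟨_, inferInstanceAs (Countable (ULift ℕ)),
      modelsTheory_of_iso (e.trans e') (hz _ (hzf x))⟩, e.trans e'⟩
  choose M hM using h
  let g : ULift.{u + 1} (Set ℕ) → Quotient (countableModelSetoid.{u} coneTheory) :=
    fun x => Quotient.mk _ (M x.down)
  have hg (q) : Cardinal.mk (g ⁻¹' {q}) ≤ Cardinal.aleph0 := by
    rw [Cardinal.le_aleph0_iff_set_countable]
    rcases (g ⁻¹' {q}).eq_empty_or_nonempty with h | ⟨x, hx⟩
    · rw [h]
      exact Set.countable_empty
    · refine Set.MapsTo.countable_of_injOn (f := fun y => f y.down)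
        (t := {y | TuringLE y (f x.down)}) (fun y hy => ?_)
        (fun y _ y' _ h => ULift.down_injective (hf h)) (countable_turingLE _)
      have h1 : (M y.down).1.Iso (M x.down).1 := Quotient.exact (hy.trans hx.symm : g y = g x)
      exact (turingEq_of_iso ((hM y.down).trans (h1.trans (hM x.down).symm))).1
  have hcard := Cardinal.mk_le_mk_mul_of_mk_preimage_le g hg
  by_contra! hlt
  refine hcard.not_gt ?_
  have : Cardinal.mk (ULift.{u + 1} (Set ℕ)) = Cardinal.continuum := by simp
  rw [this]
  exact Cardinal.mul_lt_of_lt Cardinal.aleph0_le_continuum hlt Cardinal.aleph0_lt_continuum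

end SecondOrder

/-! ### The main theorem -/

theorem mainTheorem2 (hPD : Projective.PD) :
    ∃ T : Set SecondOrder.SOFormula,
      SecondOrder.IsTheory T ∧
      SecondOrder.IsRecursive T ∧
      SecondOrder.IsComplete.{u} T ∧
      SecondOrder.numCountableModels.{u} T = Cardinal.continuum.{u + 1} ∧
      (∃ z : Set ℕ, ∀ x : Set ℕ, TuringModel.TuringLE z x →
        Countable (TuringModel.model x).carrier ∧
          SecondOrder.ModelsTheory (TuringModel.model x) T) ∧
      (∀ x y : Set ℕ, (TuringModel.model x).Iso (TuringModel.model y) →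
        TuringModel.TuringEq x y) := by
  obtain ⟨z, hz⟩ := SecondOrder.exists_cone_modelsTheory
  exact ⟨SecondOrder.coneTheory, SecondOrder.isTheory_coneTheory,
    SecondOrder.isRecursive_coneTheory, SecondOrder.isComplete_coneTheory hPD,
    SecondOrder.numCountableModels_coneTheory_le.antisymm
      SecondOrder.le_numCountableModels_coneTheory,
    ⟨z, fun x hx => ⟨TuringModel.countable_model x, hz x hx⟩⟩,
    fun _ _ => TuringModel.turingEq_of_iso⟩
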